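/- **Setting.** Let $f=(f(x,n))_{(x,n)\in\mathbb Z^2}$ be a random real field (the environment; $x$ is space, $n$ is time) whose law $P$ is invariant under all translations of $\mathbb Z^2$, is invariant under the reflection $\big(f(x,n)\big)\mapsto\big(-f(-x,n)\big)$ (the sign changes with the reflection because a positive value of $f$ pushes the walk to the right and a negative one to the left), and satisfies the FKG inequality $P(A\cap B)\ge P(A)P(B)$ for all measurable increasing events $A,B\subseteq\mathbb R^{\mathbb Z^2}$. Fix $c_0\in(0,\tfrac12)$ and $0\le\delta<\tfrac12-c_0$. Let $\mathbb L_d=(2\mathbb Z)^2\cup((1,1)+(2\mathbb Z)^2)$, let $(U_p)_{p\in\mathbb L_d}$ be i.i.d. uniform on $[0,1]$ and independent of $f$, and let $\mathbb P$ be the joint law of $f$ and $(U_p)$. At a vertex $p=(x,n)\in\mathbb L_d$ the walk jumps to $(x+1,n+1)$ if $U_p\ge\frac12-\delta\,\mathrm{sign} f(x,n)$ and to $(x-1,n+1)$ otherwise. Let $\mathbb L$ be the union of the segments joining each $p\in\mathbb L_d$ to $p+(1,1)$ and to $p+(-1,1)$. For $u=(u_1,u_2)\in\mathbb R^2$, the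 walk $(X^u_t)_{t\ge0}$ is the trajectory with $X^u_0=u_1$ such that $(X^u_t,u_2+t)$ moves straight up until it is on $\mathbb L$, then follows its segment of $\mathbb L$ upwards to a vertex of $\mathbb L_d$, and then jumps from vertex to vertex, with linear interpolation. The walk reflected at $\{x=a\}$ (for $u_1\le a$) follows the same rules, except that whenever it is on this line and would move to the right, it goes straight up along the line instead, until it meets a north-west segment of $\mathbb L$ or a vertex of $\mathbb L_d$ that sends it to the left. For $w,h>0$ let $B^u(w,h)=u+[0,w]\times[0,h]$. Let $H^u(w,h)$ be the event that for some $v$ on the left side of $B^u(w,h)$ the space-time trajectory of $X^v$ hits the right side before exiting the box. Let $V^u(w,h)$ be the event that for some $v$ on the bottom side the space-time trajectory of the walk started at $v$ and reflected at the line $\{x=u_1+w\}$ hits the top side before exiting the box (the reflected vertical crossing). With $\mathcal L_1=\{u\in\mathbb R^2:|u_1|+|u_2|\le1\}$, put, for $h\ge 2$, $$w(h)=\sup\Big\{w\ge1:\ \frac1{\mathrm{Vol}(\mathcal L_1)}\int_{\mathcal L_1}\mathbb P\big(H^u(w,h)\big)\,du\ \ge\ \frac1{\mathrm{Vol}(\mathcal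 L_1)}\int_{\mathcal L_1}\mathbb P\big(V^u(w,h)\big)\,du\Big\}.$$ **Proposition 4.4 (Vertical RSW).** For every $c_0\in(0,\frac12)$ there is a constant $c(c_0)>0$, depending only on $c_0$, such that for every environment law and every $\delta$ as above and for every real $h\ge 64\vee c(c_0)$, $$\inf_{u\in\mathbb R^2}\mathbb P\big(V^u(w(h)+4,\,5h)\big)\ \ge\ \frac{c_0^{360}}{16^{30}}.$$ -/

import Mathlib

open MeasureTheory
open scoped ENNReal

noncomputable section

namespace RWDRE

/-- The discrete space-time lattice `𝕃_d = (2ℤ)² ∪ ((1,1) + (2ℤ)²)`, as a set of integer points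
(first coordinate: space, second coordinate: time). -/
def Ld : Set (ℤ × ℤ) := {p | (Even p.1 ∧ Even p.2) ∨ (Odd p.1 ∧ Odd p.2)}

/-- The lattice `𝕃_d` as a subset of the plane. -/
def LdPlane : Set (ℝ × ℝ) := {u | ∃ p ∈ Ld, u = ((p.1 : ℝ), (p.2 : ℝ))}

/-- The continuous lattice `𝕃`: every vertex of `𝕃_d` is joined to its north-east and to its
north-west neighbour by a segment. -/
def LPlane : Set (ℝ × ℝ) :=
  {u | ∃ v ∈ LdPlane, ∃ t : ℝ, 0 ≤ t ∧ t < 1 ∧ (u = v + (t, t) ∨ u = v + (-t, t))}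

/-! ### Sample space and annealed law -/

/-- An environment is a real field on `ℤ²`. -/
abbrev Env : Type := ℤ × ℤ → ℝ

/-- A sample consists of an environment and of one number in `[0,1]` for each vertex of `𝕃_d`. -/
abbrev Sample : Type := Env × (Ld → unitInterval)

/-- The annealed law: the law `μ` of the environment times i.i.d. uniform variables on `[0,1]`
attached to the vertices of `𝕃_d`. -/
def annealed (μ : Measure Env) : Measure Sample :=
  μ.prod (Measure.infinitePi fun _ : Ld => (volume : Measure unitInterval))

/-- Invariance of the law of the environment under all translations of `ℤ²`. -/
def TranslationInvariant (μ : Measure Env) : Prop :=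
  ∀ z : ℤ × ℤ, μ.map (fun (f : Env) (p : ℤ × ℤ) => f (p + z)) = μ

/-- Invariance of the law of the environment under the reflection of space. A positive value of the
field pushes the walk to the right and a negative one to the left, so a reflection of space changes
the sign of the field as well: `f(x, n)` is replaced by `-f(-x, n)`. -/
def ReflectionInvariant (μ : Measure Env) : Prop :=
  μ.map (fun (f : Env) (p : ℤ × ℤ) => -f (-p.1, p.2)) = μ

/-- The Harris-FKG inequality: increasing events are positively correlated. -/
def FKG (μ : Measure Env) : Prop :=
  ∀ A B : Set Env, MeasurableSet A → MeasurableSet B → IsUpperSet A → IsUpperSet B →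
    μ A * μ B ≤ μ (A ∩ B)

/-! ### The graphical construction -/

/-- The vertices of `𝕃_d` from which the walk jumps to the right:
`U_{(x,n)} ≥ 1/2 - δ · sign f(x,n)`. From the other vertices it jumps to the left. -/
def arrows (δ : ℝ) (ω : Sample) : Set (ℤ × ℤ) :=
  {p | ∃ hp : p ∈ Ld, 1 / 2 - δ * Real.sign (ω.1 p) ≤ (ω.2 ⟨p, hp⟩ : ℝ)}

open Classical in
/-- One step of the walk in space-time, when `A` is the set of vertices with a jump to the
right. -/
def next (A : Set (ℤ × ℤ)) (p : ℤ × ℤ) : ℤ × ℤ :=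
  (p.1 + (if p ∈ A then 1 else -1), p.2 + 1)

/-- Spatial position after `n` steps of the walk started at the vertex `p`. -/
def vertexWalk (A : Set (ℤ × ℤ)) (p : ℤ × ℤ) (n : ℕ) : ℤ := ((next A)^[n] p).1

/-- Position at the real time `t ≥ 0` of the walk started at the vertex `p`, by linear
interpolation. -/
def vertexPath (A : Set (ℤ × ℤ)) (p : ℤ × ℤ) (t : ℝ) : ℝ :=
  vertexWalk A p ⌊t⌋₊ + (t - ⌊t⌋₊) * (vertexWalk A p (⌊t⌋₊ + 1) - vertexWalk A p ⌊t⌋₊)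

/-- The orientation of the segment of `𝕃` through `u`: `1` for north-east, `-1` for north-west. -/
def orientation (u : ℝ × ℝ) : ℝ := (-1 : ℝ) ^ (⌊u.1⌋ + ⌊u.2⌋)

/-- The time needed to reach `𝕃_d` along the segment of `𝕃` through `u` (it is `0` on `𝕃_d`). -/
def timeToLd (u : ℝ × ℝ) : ℝ :=
  sInf {s : ℝ | 0 ≤ s ∧ u + (s * orientation u, s) ∈ LdPlane}

/-- The walk started at a point `u ∈ 𝕃`: it follows its segment up to `𝕃_d`, and then it jumps from
vertex to vertex. -/
def edgePath (A : Set (ℤ × ℤ)) (u : ℝ × ℝ) (t : ℝ) : ℝ :=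
  if t ≤ timeToLd u then u.1 + orientation u * t
  else vertexPath A (⌊u.1 + orientation u * timeToLd u⌋, ⌊u.2 + timeToLd u⌋) (t - timeToLd u)

/-- The time needed to reach `𝕃` from `u`, moving straight up (it is `0` on `𝕃`). -/
def timeToL (u : ℝ × ℝ) : ℝ := sInf {s : ℝ | 0 ≤ s ∧ (u.1, u.2 + s) ∈ LPlane}

/-- The walk started at an arbitrary point `u` of the plane: it moves straight up to `𝕃`, and then it
stays on `𝕃`. Its space-time position at time `t` is `(path A u t, u.2 + t)`. -/
def path (A : Set (ℤ × ℤ)) (u : ℝ × ℝ) (t : ℝ) : ℝ :=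
  if t < timeToL u then u.1 else edgePath A (u.1, u.2 + timeToL u) (t - timeToL u)

/-- The random walk `X^u_t`. -/
def X (δ : ℝ) (ω : Sample) (u : ℝ × ℝ) (t : ℝ) : ℝ := path (arrows δ ω) u t

/-- The random walk started at `u`, with `u.1 ≤ a`, and reflected on the vertical line `{x = a}`.

It follows the rules of `X` to the left of the line. When a north-east segment, starting at a vertex
`(x, n)` with `x ≤ a < x + 1`, would take it across the line, it goes up along the line instead until
it meets the next north-west segment, which is the one from `(x + 1, n + 1)` to `(x, n + 2)`: at time
`n + s` with `0 ≤ s ≤ 2` its position is `min a (min (x + s) (x + 2 - s))`. If `a = x` this means that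
the jump to the right is suppressed, and that the walk moves up to the next vertex `(a, n + 2)` on the
line. So the trajectory is the one that is forced to turn back to the left at all vertices strictly to
the right of the line, cut off at the level `a`. -/
def reflectedX (δ : ℝ) (ω : Sample) (a : ℝ) (u : ℝ × ℝ) (t : ℝ) : ℝ :=
  min a (path {p | p ∈ arrows δ ω ∧ (p.1 : ℝ) ≤ a} u t)

/-! ### Crossing events -/

/-- The box `B^u(w, h) = u + [0, w] × [0, h]`. -/
def box (u : ℝ × ℝ) (w h : ℝ) : Set (ℝ × ℝ) :=
  {v | u.1 ≤ v.1 ∧ v.1 ≤ u.1 + w ∧ u.2 ≤ v.2 ∧ v.2 ≤ u.2 + h}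

/-- The left face of the box. -/
def leftFace (u : ℝ × ℝ) (w h : ℝ) : Set (ℝ × ℝ) := {v ∈ box u w h | v.1 = u.1}

/-- The right face of the box. -/
def rightFace (u : ℝ × ℝ) (w h : ℝ) : Set (ℝ × ℝ) := {v ∈ box u w h | v.1 = u.1 + w}

/-- The bottom face of the box. -/
def bottomFace (u : ℝ × ℝ) (w h : ℝ) : Set (ℝ × ℝ) := {v ∈ box u w h | v.2 = u.2}

/-- The top face of the box. -/
def topFace (u : ℝ × ℝ) (w h : ℝ) : Set (ℝ × ℝ) := {v ∈ box u w h | v.2 = u.2 + h}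

/-- For a family of trajectories `γ v`, indexed by their starting points `v`: some trajectory started
in `S` hits `T` before exiting `C`. -/
def Crosses (γ : ℝ × ℝ → ℝ → ℝ) (S T C : Set (ℝ × ℝ)) : Prop :=
  ∃ v ∈ S, ∃ t : ℝ, 0 ≤ t ∧ (γ v t, v.2 + t) ∈ T ∧
    ∀ s : ℝ, 0 ≤ s → s ≤ t → (γ v s, v.2 + s) ∈ C

/-- The horizontal (left-right) crossing event `H^u(w, h)`. -/
def H (δ : ℝ) (u : ℝ × ℝ) (w h : ℝ) : Set Sample :=
  {ω | Crosses (X δ ω) (leftFace u w h) (rightFace u w h) (box u w h)}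

/-- The vertical (bottom-top) crossing event `V^u(w, h)`, with reflection on the right side of the
box. -/
def V (δ : ℝ) (u : ℝ × ℝ) (w h : ℝ) : Set Sample :=
  {ω | Crosses (reflectedX δ ω (u.1 + w)) (bottomFace u w h) (topFace u w h) (box u w h)}

/-! ### The fluctuation scale -/

/-- The rhombus `{u : ‖u‖₁ ≤ 1}`. -/
def rhombus : Set (ℝ × ℝ) := {u | |u.1| + |u.2| ≤ 1}

/-- The fluctuation scale `w(h)`: the supremum of the widths `w ≥ 1` such that, averaged over anchor
points in the rhombus, a horizontal crossing of a `w × h` box is at least as likely as a reflected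
vertical crossing. -/
def fluctuationScale (μ : Measure Env) (δ h : ℝ) : ℝ :=
  sSup {w : ℝ | 1 ≤ w ∧
    (volume rhombus)⁻¹ * ∫⁻ u in rhombus, annealed μ (V δ u w h) ≤
      (volume rhombus)⁻¹ * ∫⁻ u in rhombus, annealed μ (H δ u w h)}

end RWDRE

end

/-!
A walk reflected at the right side of a strip is pushed further to the right if arrows are turned to
the right, and so is a walk that crosses the strip from left to right. Both crossing events are
increasing, hence positively correlated: Harris' inequality handles the arrows in a fixed
environment and the FKG hypothesis the environment (`DeterminedBy.prob_mul_le`).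

Crossings obey a duality. If the reflected walk leaves the strip through its left side, then after
its last visit to the right side it crosses the strip from right to left, which in a mirror is a
horizontal crossing (`one_le_prob_add_prob`). So, up to a bounded change of the dimensions,
horizontal crossings of width `w` and height `h` have probability at least `1 / 3` for some `w` just
below the fluctuation scale (`le_prob_horizontal_of_mem`), and vertical crossings have this
probability just above it (`le_prob_vertical_of_notMem`). The argument compares upper bounds with
lower bounds that are uniform in the anchor point, so it does not need the measurability of the
averaged functions. The supremum that defines the scale is not degenerate: for large `h` a walk is
likely to leave a narrow strip before time `h` (`one_mem_admissibleWidths`), and walks have speed at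
most one (`bddAbove_admissibleWidths`).

The remaining gap of a few columns between the two widths is closed by forcing a bounded number of
jumps to the right at the end of a horizontal crossing, each at the price of a factor `c₀`
(`mul_prob_horizontal_le`).

Vertical crossings are lengthened in a strip of fixed width. Let a vertical crossing last until time
`N`. Cut the time span of a horizontal crossing into two slabs of length `K`, about `h / 2`; for one
of the possible relative positions of the slabs of its two endpoints the crossing still has a good
probability (`exists_slab`). Place the first slab at the times from `N - K` to `N`. The reflected
walk is then to the right of the horizontal crossing when that crossing starts, so it is carried to
the right side of the strip; from there on it dominates a second vertical crossing, started at the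
beginning of the slab of arrival. The result survives until about time `N + h / 2`
(`mem_vertical_of_horizontal`). Ten such steps exceed the height `5 h`.

All of this takes place on the vertices of `𝕃_d`; the comparison with the trajectories in the plane
rests on the formula `path_cases` for a trajectory before its first vertex.
-/

namespace RWDRE

section

/-! ### Laws of arrow configurations -/

/-- The law of the i.i.d. uniform variables attached to the vertices of `𝕃_d`. -/
noncomputable abbrev uniforms : Measure (Ld → unitInterval) :=
  Measure.infinitePi fun _ : Ld => (volume : Measure unitInterval)

/-- The annealed probability that the set of vertices with a jump to the right lies in `E`. -/
noncomputable def prob (μ : Measure Env) (δ : ℝ) (E : Set (Set (ℤ × ℤ))) : ℝ :=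
  (annealed μ).real {ω | arrows δ ω ∈ E}

/-- The quenched probability, in the environment `f`, that the set of vertices with a jump to the
right lies in `E`. -/
noncomputable def quenched (δ : ℝ) (f : Env) (E : Set (Set (ℤ × ℤ))) : ℝ :=
  uniforms.real {U | arrows δ (f, U) ∈ E}

/-- The quenched probability of a jump to the right at the vertex `v`. -/
noncomputable def jumpProb (δ : ℝ) (f : Env) (v : ℤ × ℤ) : ℝ := 1 / 2 + δ * Real.sign (f v)

/-- The event `E` only looks at the arrows at the finitely many vertices in `F`. -/
def DeterminedBy (F : Finset Ld) (E : Set (Set (ℤ × ℤ))) : Prop :=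
  ∀ A B : Set (ℤ × ℤ), (∀ v ∈ F, (v : ℤ × ℤ) ∈ A ↔ (v : ℤ × ℤ) ∈ B) → (A ∈ E ↔ B ∈ E)

/-- The set of vertices in `F` that are marked by `σ`. -/
def markedSet (F : Finset Ld) (σ : F → Bool) : Set (ℤ × ℤ) :=
  {x | ∃ v : F, ((v : Ld) : ℤ × ℤ) = x ∧ σ v = true}

lemma coe_mem_markedSet {F : Finset Ld} {σ : F → Bool} {v : Ld} (hv : v ∈ F) :
    (v : ℤ × ℤ) ∈ markedSet F σ ↔ σ ⟨v, hv⟩ = true := by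
  constructor
  · rintro ⟨w, hw, h⟩
    have : w = ⟨v, hv⟩ := Subtype.ext (Subtype.ext hw)
    rwa [this] at h
  · exact fun h => ⟨⟨v, hv⟩, rfl, h⟩

lemma DeterminedBy.inter {F : Finset Ld} {E E' : Set (Set (ℤ × ℤ))} (h : DeterminedBy F E)
    (h' : DeterminedBy F E') : DeterminedBy F (E ∩ E') :=
  fun A B hAB => and_congr (h A B hAB) (h' A B hAB)

lemma DeterminedBy.compl {F : Finset Ld} {E : Set (Set (ℤ × ℤ))} (h : DeterminedBy F E) :
    DeterminedBy F Eᶜ :=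
  fun A B hAB => not_congr (h A B hAB)

lemma DeterminedBy.mono {F F' : Finset Ld} {E : Set (Set (ℤ × ℤ))} (h : DeterminedBy F E)
    (hF : F ⊆ F') : DeterminedBy F' E :=
  fun A B hAB => h A B fun v hv => hAB v (hF hv)

lemma coe_mem_arrows {δ : ℝ} {ω : Sample} {v : Ld} :
    (v : ℤ × ℤ) ∈ arrows δ ω ↔ 1 / 2 - δ * Real.sign (ω.1 v) ≤ (ω.2 v : ℝ) :=
  ⟨fun ⟨_, h⟩ => h, fun h => ⟨v.2, h⟩⟩

lemma arrows_subset {δ : ℝ} {ω : Sample} : arrows δ ω ⊆ Ld := fun _ ⟨h, _⟩ => h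

lemma measurable_sign : Measurable Real.sign := by
  unfold Real.sign
  exact Measurable.ite measurableSet_Iio measurable_const
    (Measurable.ite measurableSet_Ioi measurable_const measurable_const)

lemma monotone_sign : Monotone Real.sign := by
  intro a b hab
  rcases lt_trichotomy a 0 with h | rfl | h <;> rcases lt_trichotomy b 0 with h' | rfl | h' <;>
    simp [Real.sign_of_neg, Real.sign_of_pos, *] <;> linarith

lemma measurableSet_coe_mem_arrows (δ : ℝ) (v : Ld) :
    MeasurableSet {ω : Sample | (v : ℤ × ℤ) ∈ arrows δ ω} := by
  simp only [coe_mem_arrows]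
  have h := measurable_sign
  exact measurableSet_le (by fun_prop) (by fun_prop)

lemma DeterminedBy.measurableSet {F : Finset Ld} {E : Set (Set (ℤ × ℤ))} (h : DeterminedBy F E)
    (δ : ℝ) : MeasurableSet {ω : Sample | arrows δ ω ∈ E} := by
  classical
  let π : Sample → F → Bool := fun ω v => decide (((v : Ld) : ℤ × ℤ) ∈ arrows δ ω)
  have hπ : Measurable π := by
    refine measurable_pi_iff.2 fun v => measurable_to_bool ?_
    convert measurableSet_coe_mem_arrows δ v.1 using 1
    ext ω
    simp [π]
  have : {ω : Sample | arrows δ ω ∈ E} = π ⁻¹' {σ | markedSet F σ ∈ E} := by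
    ext ω
    refine h _ _ fun v hv => ?_
    rw [coe_mem_markedSet hv]
    simp [π]
  rw [this]
  exact hπ (Set.toFinite _).measurableSet

lemma DeterminedBy.measurableSet_section {F : Finset Ld} {E : Set (Set (ℤ × ℤ))}
    (h : DeterminedBy F E) (δ : ℝ) (f : Env) :
    MeasurableSet {U : Ld → unitInterval | arrows δ (f, U) ∈ E} :=
  measurable_prodMk_left (h.measurableSet δ)

lemma quenched_nonneg {δ : ℝ} {f : Env} {E : Set (Set (ℤ × ℤ))} : 0 ≤ quenched δ f E :=
  measureReal_nonneg

lemma quenched_le_one {δ : ℝ} {f : Env} {E : Set (Set (ℤ × ℤ))} : quenched δ f E ≤ 1 :=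
  measureReal_le_one

lemma DeterminedBy.measurable_quenched {F : Finset Ld} {E : Set (Set (ℤ × ℤ))}
    (h : DeterminedBy F E) (δ : ℝ) : Measurable fun f => quenched δ f E :=
  (measurable_measure_prodMk_left (h.measurableSet δ)).ennreal_toReal

variable {μ : Measure Env} {δ : ℝ}

instance [IsProbabilityMeasure μ] : IsProbabilityMeasure (annealed μ) := by
  unfold annealed
  infer_instance

lemma DeterminedBy.prob_eq {F : Finset Ld} {E : Set (Set (ℤ × ℤ))}
    (h : DeterminedBy F E) : prob μ δ E = ∫ f, quenched δ f E ∂μ := by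
  rw [prob, measureReal_def, annealed, Measure.prod_apply (h.measurableSet δ),
    ← integral_toReal (measurable_measure_prodMk_left (h.measurableSet δ)).aemeasurable
      (Filter.Eventually.of_forall fun _ => measure_lt_top _ _)]
  rfl

lemma prob_nonneg {E : Set (Set (ℤ × ℤ))} : 0 ≤ prob μ δ E := measureReal_nonneg

lemma prob_le_one [IsProbabilityMeasure μ] {E : Set (Set (ℤ × ℤ))} : prob μ δ E ≤ 1 :=
  measureReal_le_one

lemma prob_union_le (E E' : Set (Set (ℤ × ℤ))) :
    prob μ δ (E ∪ E') ≤ prob μ δ E + prob μ δ E' :=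
  measureReal_union_le _ _

lemma DeterminedBy.integrable_quenched [IsProbabilityMeasure μ] {F : Finset Ld}
    {E : Set (Set (ℤ × ℤ))}
    (h : DeterminedBy F E) : Integrable (fun f => quenched δ f E) μ :=
  Integrable.of_bound (h.measurable_quenched δ).aestronglyMeasurable 1
    (Filter.Eventually.of_forall fun f => by
      rw [Real.norm_of_nonneg quenched_nonneg]; exact quenched_le_one)

lemma prob_mono [IsProbabilityMeasure μ] {E E' : Set (Set (ℤ × ℤ))}
    (h : ∀ A, A ⊆ Ld → A ∈ E → A ∈ E') :
    prob μ δ E ≤ prob μ δ E' :=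
  measureReal_mono fun _ hω => h _ arrows_subset hω

lemma DeterminedBy.prob_compl [IsProbabilityMeasure μ] {F : Finset Ld} {E : Set (Set (ℤ × ℤ))}
    (h : DeterminedBy F E) : prob μ δ Eᶜ = 1 - prob μ δ E :=
  probReal_compl_eq_one_sub (h.measurableSet δ)

lemma DeterminedBy.prob_union [IsProbabilityMeasure μ] {F : Finset Ld} {E E' : Set (Set (ℤ × ℤ))}
    (h : DeterminedBy F E') (hd : Disjoint E E') :
    prob μ δ (E ∪ E') = prob μ δ E + prob μ δ E' :=
  measureReal_union (Set.disjoint_left.2 fun _ h1 h2 => Set.disjoint_left.1 hd h1 h2)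
    (h.measurableSet δ)

/-! ### Quenched laws are product laws -/

lemma jumpProb_mem (hδ : 0 ≤ δ) (hδ' : δ ≤ 1 / 2) (f : Env) (v : ℤ × ℤ) :
    0 ≤ 1 / 2 - δ * Real.sign (f v) ∧ 1 / 2 - δ * Real.sign (f v) ≤ 1 := by
  rcases Real.sign_apply_eq (f v) with h | h | h <;> rw [h] <;> constructor <;> linarith

lemma volume_jump (hδ : 0 ≤ δ) (hδ' : δ ≤ 1 / 2) (f : Env) (v : ℤ × ℤ) (P : Prop) [Decidable P] :
    (volume : Measure unitInterval) {x | 1 / 2 - δ * Real.sign (f v) ≤ (x : ℝ) ↔ P} =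
      ENNReal.ofReal (if P then jumpProb δ f v else 1 - jumpProb δ f v) := by
  let c : unitInterval := ⟨1 / 2 - δ * Real.sign (f v), jumpProb_mem hδ hδ' f v⟩
  by_cases hP : P
  · have : {x : unitInterval | 1 / 2 - δ * Real.sign (f v) ≤ (x : ℝ) ↔ P} = Set.Ici c := by
      ext x; simp [hP, c, ← Subtype.coe_le_coe]
    rw [this, unitInterval.volume_Ici, if_pos hP]
    congr 1
    simp only [c, jumpProb]; ring
  · have : {x : unitInterval | 1 / 2 - δ * Real.sign (f v) ≤ (x : ℝ) ↔ P} = Set.Iio c := by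
      ext x
      simp only [hP, iff_false, not_le, c, Set.mem_ofPred_eq, Set.mem_Iio, ← Subtype.coe_lt_coe]
    rw [this, unitInterval.volume_Iio, if_neg hP]
    congr 1
    simp only [c, jumpProb]; ring

open Classical in
lemma quenched_cylinder (hδ : 0 ≤ δ) (hδ' : δ ≤ 1 / 2) (f : Env) (e : Ld ≃ Ld) (F : Finset Ld)
    (b : Ld → Prop) :
    quenched δ f {A | ∀ v ∈ F, ((e v : Ld) : ℤ × ℤ) ∈ A ↔ b v} =
      ∏ v ∈ F, if b v then jumpProb δ f (e v) else 1 - jumpProb δ f (e v) := by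
  have hset : {U : Ld → unitInterval | arrows δ (f, U) ∈
      {A | ∀ v ∈ F, ((e v : Ld) : ℤ × ℤ) ∈ A ↔ b v}} =
      Set.pi ((F.map e.toEmbedding : Finset Ld) : Set Ld)
        (fun w : Ld =>
          {x : unitInterval | 1 / 2 - δ * Real.sign (f w) ≤ (x : ℝ) ↔ b (e.symm w)}) := by
    ext U
    simp only [Set.mem_ofPred_eq, Set.mem_pi, Finset.coe_map, Set.mem_image, coe_mem_arrows]
    constructor
    · rintro h _ ⟨v, hv, rfl⟩
      simpa using h v hv
    · intro h v hv
      simpa using h (e v) ⟨v, hv, rfl⟩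
  rw [quenched, hset, measureReal_def, Measure.infinitePi_pi, Finset.prod_map, ENNReal.toReal_prod]
  · refine Finset.prod_congr rfl fun v _ => ?_
    rw [volume_jump hδ hδ', ENNReal.toReal_ofReal]
    · simp
    · have := jumpProb_mem hδ hδ' f (e v)
      simp only [Equiv.coe_toEmbedding]
      split_ifs <;> unfold jumpProb <;> linarith
  · intro w _
    by_cases hb : b (e.symm w)
    · simp only [hb, iff_true]
      exact measurableSet_le measurable_const measurable_subtype_coe
    · simp only [hb, iff_false, not_le]
      exact measurableSet_lt measurable_subtype_coe measurable_const

open Classical in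
/-- The quenched law of the image of the set of arrows under a map that relabels the vertices by `e`
and, if `s` is false, also reverses the arrows. -/
lemma DeterminedBy.quenched_preimage {F : Finset Ld} {E : Set (Set (ℤ × ℤ))}
    (h : DeterminedBy F E) (hδ : 0 ≤ δ) (hδ' : δ ≤ 1 / 2) (f : Env) (e : Ld ≃ Ld)
    (T : Set (ℤ × ℤ) → Set (ℤ × ℤ)) (s : Prop)
    (hT : ∀ A, ∀ v : Ld, (v : ℤ × ℤ) ∈ T A ↔ (((e v : Ld) : ℤ × ℤ) ∈ A ↔ s)) :
    quenched δ f {A | T A ∈ E} = ∑ σ : F → Bool,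
      (∏ v : F, if σ v then (if s then jumpProb δ f (e v) else 1 - jumpProb δ f (e v)) else
        1 - (if s then jumpProb δ f (e v) else 1 - jumpProb δ f (e v))) *
          (if markedSet F σ ∈ E then 1 else 0) := by
  let π : (Ld → unitInterval) → F → Bool :=
    fun U v => decide (((v : Ld) : ℤ × ℤ) ∈ T (arrows δ (f, U)))
  have hfib : ∀ σ : F → Bool, π ⁻¹' {σ} = {U | arrows δ (f, U) ∈
      {A | ∀ v ∈ F, ((e v : Ld) : ℤ × ℤ) ∈ A ↔ ((v : ℤ × ℤ) ∈ markedSet F σ ↔ s)}} := by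
    intro σ
    ext U
    simp only [Set.mem_preimage, Set.mem_singleton_iff, funext_iff, π, Set.mem_ofPred_eq, hT]
    constructor
    · intro hU v hv
      have := hU ⟨v, hv⟩
      rw [coe_mem_markedSet hv, ← this]
      simp only [decide_eq_true_eq]
      tauto
    · intro hU v
      have := hU v.1 v.2
      rw [coe_mem_markedSet v.2] at this
      rw [Bool.eq_iff_iff, decide_eq_true_eq]
      simp only [Subtype.coe_eta] at this
      tauto
  have hmeas : ∀ σ : F → Bool, MeasurableSet (π ⁻¹' {σ}) := by
    intro σ
    rw [hfib]
    refine DeterminedBy.measurableSet_section (F := F.map e.toEmbedding) ?_ δ f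
    intro A B hAB
    refine forall₂_congr fun v hv => ?_
    rw [hAB (e v) (Finset.mem_map_of_mem _ hv)]
  have hpre : {U : Ld → unitInterval | arrows δ (f, U) ∈ {A | T A ∈ E}} =
      π ⁻¹' ((Finset.univ.filter fun σ => markedSet F σ ∈ E : Finset (F → Bool)) :
        Set (F → Bool)) := by
    ext U
    simp only [Set.mem_ofPred_eq, Set.mem_preimage, Finset.coe_filter, Finset.mem_univ, true_and]
    refine h _ _ fun v hv => ?_
    rw [coe_mem_markedSet hv]
    simp [π]
  rw [quenched, hpre, ← sum_measureReal_preimage_singleton _ (fun σ _ => hmeas σ),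
    Finset.sum_filter]
  refine Finset.sum_congr rfl fun σ _ => ?_
  rw [mul_ite, mul_one, mul_zero]
  refine if_congr Iff.rfl ?_ rfl
  rw [hfib]
  refine (quenched_cylinder hδ hδ' f e F _).trans ?_
  rw [← Finset.prod_coe_sort]
  refine Finset.prod_congr rfl fun v _ => ?_
  rw [coe_mem_markedSet v.2]
  by_cases h1 : σ v = true <;> by_cases h2 : s <;> simp [h1, h2]

open Classical in
lemma DeterminedBy.quenched_eq {F : Finset Ld} {E : Set (Set (ℤ × ℤ))}
    (h : DeterminedBy F E) (hδ : 0 ≤ δ) (hδ' : δ ≤ 1 / 2) (f : Env) :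
    quenched δ f E = ∑ σ : F → Bool,
      (∏ v : F, if σ v then jumpProb δ f v else 1 - jumpProb δ f v) *
          (if markedSet F σ ∈ E then 1 else 0) := by
  have := h.quenched_preimage hδ hδ' f (Equiv.refl _) id True (by simp)
  simpa using this

/-- A symmetry of the law of the environment, which may relabel vertices and reverse arrows, leaves
the annealed law of the set of arrows invariant. -/
lemma DeterminedBy.prob_preimage {F : Finset Ld} {E : Set (Set (ℤ × ℤ))}
    (h : DeterminedBy F E) (hδ : 0 ≤ δ) (hδ' : δ ≤ 1 / 2) (e : Ld ≃ Ld)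
    (T : Set (ℤ × ℤ) → Set (ℤ × ℤ)) (s : Prop) [Decidable s]
    (hT : ∀ A, ∀ v : Ld, (v : ℤ × ℤ) ∈ T A ↔ (((e v : Ld) : ℤ × ℤ) ∈ A ↔ s))
    (τ : Env → Env) (hτm : Measurable τ) (hτ : μ.map τ = μ)
    (hτp : ∀ f, ∀ v : Ld, jumpProb δ (τ f) v =
      if s then jumpProb δ f (e v) else 1 - jumpProb δ f (e v)) :
    prob μ δ {A | T A ∈ E} = prob μ δ E := by
  have hdet : DeterminedBy (F.map e.toEmbedding) {A | T A ∈ E} := by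
    intro A B hAB
    refine h _ _ fun v hv => ?_
    rw [hT, hT, hAB (e v) (Finset.mem_map_of_mem _ hv)]
  rw [h.prob_eq, hdet.prob_eq]
  conv_rhs => rw [← hτ, integral_map hτm.aemeasurable
    (h.measurable_quenched δ).aestronglyMeasurable]
  refine integral_congr_ae (Filter.Eventually.of_forall fun f => ?_)
  simp only
  rw [h.quenched_preimage hδ hδ' f e T s hT, h.quenched_eq hδ hδ']
  simp only [hτp]
  congr! 6

lemma add_mem_Ld {p z : ℤ × ℤ} (hz : z ∈ Ld) : p + z ∈ Ld ↔ p ∈ Ld := by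
  simp only [Ld, Set.mem_ofPred_eq, Prod.fst_add, Prod.snd_add, Int.even_iff, Int.odd_iff] at *
  omega

lemma mirror_mem_Ld {p : ℤ × ℤ} : (-p.1, p.2) ∈ Ld ↔ p ∈ Ld := by
  simp only [Ld, Set.mem_ofPred_eq, Int.even_iff, Int.odd_iff]
  omega

lemma DeterminedBy.prob_translate {F : Finset Ld} {E : Set (Set (ℤ × ℤ))} (h : DeterminedBy F E)
    (hμ : TranslationInvariant μ) (hδ : 0 ≤ δ) (hδ' : δ ≤ 1 / 2) {z : ℤ × ℤ} (hz : z ∈ Ld) :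
    prob μ δ {A | {p | p + z ∈ A} ∈ E} = prob μ δ E := by
  let e : Ld ≃ Ld := (Equiv.addRight z).subtypeEquiv fun p => (add_mem_Ld hz).symm
  have he : ∀ v : Ld, ((e v : Ld) : ℤ × ℤ) = v + z := fun _ => rfl
  refine h.prob_preimage hδ hδ' e (fun A => {p | p + z ∈ A}) True (fun A v => ?_)
    (fun f p => f (p + z)) (by fun_prop) (hμ z) fun f v => ?_
  · simp [he]
  · simp [he, jumpProb]

/-- The set of arrows seen in a mirror that reverses space. -/
def mirror (A : Set (ℤ × ℤ)) : Set (ℤ × ℤ) := {p | p ∈ Ld ∧ (-p.1, p.2) ∉ A}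

lemma DeterminedBy.prob_mirror {F : Finset Ld} {E : Set (Set (ℤ × ℤ))} (h : DeterminedBy F E)
    (hμ : ReflectionInvariant μ) (hδ : 0 ≤ δ) (hδ' : δ ≤ 1 / 2) :
    prob μ δ {A | mirror A ∈ E} = prob μ δ E := by
  let e : Ld ≃ Ld := ((Equiv.neg ℤ).prodCongr (Equiv.refl ℤ)).subtypeEquiv
    fun p => mirror_mem_Ld.symm
  have he : ∀ v : Ld, ((e v : Ld) : ℤ × ℤ) = (-(v : ℤ × ℤ).1, (v : ℤ × ℤ).2) := fun _ => rfl
  refine h.prob_preimage hδ hδ' e mirror False (fun A v => ?_)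
    (fun f p => -f (-p.1, p.2)) (by fun_prop) hμ fun f v => ?_
  · simp [he, mirror]
  · simp only [he, jumpProb, Real.sign_neg, if_false]
    ring

end

section

variable {μ : Measure Env} [IsProbabilityMeasure μ] {δ : ℝ}

/-! ### Positive association -/

lemma volume_setOf_lt {x : ℝ} (hx : x ∈ Set.Icc (0 : ℝ) 1) :
    (volume : Measure unitInterval) {t | (t : ℝ) < x} = ENNReal.ofReal x := by
  have : {t : unitInterval | (t : ℝ) < x} = Set.Iio ⟨x, hx⟩ := by
    ext t
    simp [← Subtype.coe_lt_coe]
  rw [this, unitInterval.volume_Iio]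

/-- The FKG inequality for increasing functions: write both functions as mixtures of indicator
functions of their superlevel sets. -/
lemma FKG.lintegral_mul_le (hμ : FKG μ) {g₁ g₂ : Env → ℝ} (hm₁ : Measurable g₁)
    (hm₂ : Measurable g₂) (h₁ : Monotone g₁) (h₂ : Monotone g₂)
    (hI₁ : ∀ f, g₁ f ∈ Set.Icc (0 : ℝ) 1) (hI₂ : ∀ f, g₂ f ∈ Set.Icc (0 : ℝ) 1) :
    (∫⁻ f, ENNReal.ofReal (g₁ f) ∂μ) * ∫⁻ f, ENNReal.ofReal (g₂ f) ∂μ ≤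
      ∫⁻ f, ENNReal.ofReal (g₁ f) * ENNReal.ofReal (g₂ f) ∂μ := by
  let ν : Measure unitInterval := volume
  have layer : ∀ g : Env → ℝ, Measurable g → (∀ f, g f ∈ Set.Icc (0 : ℝ) 1) →
      ∫⁻ f, ENNReal.ofReal (g f) ∂μ = ∫⁻ t, μ {f | (t : ℝ) < g f} ∂ν := by
    intro g hg hI
    have hS : MeasurableSet {p : Env × unitInterval | (p.2 : ℝ) < g p.1} :=
      measurableSet_lt (by fun_prop) (by fun_prop)
    have e := Measure.prod_apply (μ := μ) (ν := ν) hS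
    rw [Measure.prod_apply_symm hS] at e
    calc _ = ∫⁻ f, ν {t | (t : ℝ) < g f} ∂μ :=
          lintegral_congr fun f => (volume_setOf_lt (hI f)).symm
      _ = _ := e.symm
  have hT : MeasurableSet {p : Env × (unitInterval × unitInterval) |
      (p.2.1 : ℝ) < g₁ p.1 ∧ (p.2.2 : ℝ) < g₂ p.1} := by
    rw [Set.ofPred_and]
    exact (measurableSet_lt (by fun_prop) (by fun_prop)).inter
      (measurableSet_lt (by fun_prop) (by fun_prop))
  have e := Measure.prod_apply (μ := μ) (ν := ν.prod ν) hT
  rw [Measure.prod_apply_symm hT] at e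
  have hmeas : ∀ g : Env → ℝ, Measurable g →
      Measurable fun t : unitInterval => μ {f | (t : ℝ) < g f} := by
    intro g hg
    exact measurable_measure_prodMk_right (μ := μ)
      (s := {p : Env × unitInterval | (p.2 : ℝ) < g p.1})
      (measurableSet_lt (by fun_prop) (by fun_prop))
  calc _ = ∫⁻ p, μ {f | (p.1 : ℝ) < g₁ f} * μ {f | (p.2 : ℝ) < g₂ f} ∂(ν.prod ν) := by
        rw [layer g₁ hm₁ hI₁, layer g₂ hm₂ hI₂,
          lintegral_prod_mul (hmeas g₁ hm₁).aemeasurable (hmeas g₂ hm₂).aemeasurable]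
    _ ≤ ∫⁻ p, μ {f | (p.1 : ℝ) < g₁ f ∧ (p.2 : ℝ) < g₂ f} ∂(ν.prod ν) := by
        refine lintegral_mono fun p => ?_
        exact hμ _ _ (measurableSet_lt measurable_const hm₁) (measurableSet_lt measurable_const hm₂)
          (fun f f' hf h => lt_of_lt_of_le h (h₁ hf)) (fun f f' hf h => lt_of_lt_of_le h (h₂ hf))
    _ = ∫⁻ f, (ν.prod ν) {p | (p.1 : ℝ) < g₁ f ∧ (p.2 : ℝ) < g₂ f} ∂μ := e
    _ = _ := by
        refine lintegral_congr fun f => ?_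
        rw [← volume_setOf_lt (hI₁ f), ← volume_setOf_lt (hI₂ f)]
        rw [← Measure.prod_prod]
        rfl

lemma FKG.integral_mul_le (hμ : FKG μ) {g₁ g₂ : Env → ℝ} (hm₁ : Measurable g₁)
    (hm₂ : Measurable g₂) (h₁ : Monotone g₁) (h₂ : Monotone g₂)
    (hI₁ : ∀ f, g₁ f ∈ Set.Icc (0 : ℝ) 1) (hI₂ : ∀ f, g₂ f ∈ Set.Icc (0 : ℝ) 1) :
    (∫ f, g₁ f ∂μ) * ∫ f, g₂ f ∂μ ≤ ∫ f, g₁ f * g₂ f ∂μ := by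
  have h := hμ.lintegral_mul_le hm₁ hm₂ h₁ h₂ hI₁ hI₂
  have p₁ : ∀ f, 0 ≤ g₁ f := fun f => (hI₁ f).1
  have p₂ : ∀ f, 0 ≤ g₂ f := fun f => (hI₂ f).1
  have i₁ : Integrable g₁ μ := Integrable.of_bound hm₁.aestronglyMeasurable 1
    (Filter.Eventually.of_forall fun f => by rw [Real.norm_of_nonneg (p₁ f)]; exact (hI₁ f).2)
  have i₂ : Integrable g₂ μ := Integrable.of_bound hm₂.aestronglyMeasurable 1
    (Filter.Eventually.of_forall fun f => by rw [Real.norm_of_nonneg (p₂ f)]; exact (hI₂ f).2)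
  have i₃ : Integrable (fun f => g₁ f * g₂ f) μ :=
    Integrable.of_bound (hm₁.mul hm₂).aestronglyMeasurable 1 <|
      Filter.Eventually.of_forall fun f => by
      rw [Real.norm_of_nonneg (mul_nonneg (p₁ f) (p₂ f))]
      exact mul_le_one₀ (hI₁ f).2 (p₂ f) (hI₂ f).2
  simp_rw [← ENNReal.ofReal_mul (p₁ _)] at h
  rw [← ofReal_integral_eq_lintegral_ofReal i₁ (Filter.Eventually.of_forall p₁),
    ← ofReal_integral_eq_lintegral_ofReal i₂ (Filter.Eventually.of_forall p₂),
    ← ofReal_integral_eq_lintegral_ofReal i₃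
      (Filter.Eventually.of_forall fun f => mul_nonneg (p₁ f) (p₂ f)),
    ← ENNReal.ofReal_mul (integral_nonneg p₁)] at h
  exact (ENNReal.ofReal_le_ofReal_iff (integral_nonneg fun f => mul_nonneg (p₁ f) (p₂ f))).1 h

open Classical in
/-- Harris' inequality for the arrows in a fixed environment. -/
lemma DeterminedBy.quenched_mul_le {F : Finset Ld} {E E' : Set (Set (ℤ × ℤ))}
    (h : DeterminedBy F E) (h' : DeterminedBy F E') (hE : IsUpperSet E) (hE' : IsUpperSet E')
    (hδ : 0 ≤ δ) (hδ' : δ ≤ 1 / 2) (f : Env) :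
    quenched δ f E * quenched δ f E' ≤ quenched δ f (E ∩ E') := by
  let w : (F → Bool) → ℝ := fun σ => ∏ v : F, if σ v then jumpProb δ f v else 1 - jumpProb δ f v
  have hp : ∀ v : ℤ × ℤ, 0 ≤ jumpProb δ f v ∧ 0 ≤ 1 - jumpProb δ f v := fun v => by
    have := jumpProb_mem hδ hδ' f v
    unfold jumpProb
    constructor <;> linarith
  have mono : ∀ E : Set (Set (ℤ × ℤ)), IsUpperSet E →
      Monotone fun σ : F → Bool => if markedSet F σ ∈ E then (1 : ℝ) else 0 := by
    intro E hE σ τ hστ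
    have hle : markedSet F σ ⊆ markedSet F τ := fun x ⟨v, hv, hσ⟩ => ⟨v, hv, by
      have := hστ v
      rw [hσ] at this
      exact top_le_iff.1 this⟩
    by_cases h1 : markedSet F σ ∈ E
    · simp [h1, hE hle h1]
    · simp only [h1, if_false]
      positivity
  have key := fkg (μ := w) (f := fun σ => if markedSet F σ ∈ E then (1 : ℝ) else 0)
    (g := fun σ => if markedSet F σ ∈ E' then (1 : ℝ) else 0)
    (fun σ => Finset.prod_nonneg fun v _ => by split_ifs <;> simp [hp])
    (fun σ => by simp only [Pi.zero_apply]; positivity)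
    (fun σ => by simp only [Pi.zero_apply]; positivity) (mono E hE) (mono E' hE')
    (fun σ τ => by
      simp only [w, ← Finset.prod_mul_distrib]
      refine le_of_eq (Finset.prod_congr rfl fun v _ => ?_)
      rcases h1 : σ v <;> rcases h2 : τ v <;> simp [h1, h2, mul_comm])
  have hone : ∑ σ, w σ = 1 := by
    have hu : DeterminedBy F Set.univ := fun _ _ _ => by simp
    have := hu.quenched_eq hδ hδ' f
    simp only [Set.mem_univ, if_true, mul_one] at this
    rw [← this]
    simp [quenched]
  rw [hone, one_mul] at key
  rw [h.quenched_eq hδ hδ' f, h'.quenched_eq hδ hδ' f, (h.inter h').quenched_eq hδ hδ' f]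
  refine key.trans (le_of_eq (Finset.sum_congr rfl fun σ _ => ?_))
  by_cases h1 : markedSet F σ ∈ E <;> by_cases h2 : markedSet F σ ∈ E' <;> simp [h1, h2, w]

open Classical in
lemma DeterminedBy.inter_union {F F' : Finset Ld} {E E' : Set (Set (ℤ × ℤ))}
    (h : DeterminedBy F E) (h' : DeterminedBy F' E') : DeterminedBy (F ∪ F') (E ∩ E') :=
  (h.mono Finset.subset_union_left).inter (h'.mono Finset.subset_union_right)

/-- Increasing events of the arrows are positively correlated under the annealed law. -/
lemma DeterminedBy.prob_mul_le {F F' : Finset Ld} {E E' : Set (Set (ℤ × ℤ))}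
    (h : DeterminedBy F E) (h' : DeterminedBy F' E') (hE : IsUpperSet E) (hE' : IsUpperSet E')
    (hμ : FKG μ) (hδ : 0 ≤ δ) (hδ' : δ ≤ 1 / 2) :
    prob μ δ E * prob μ δ E' ≤ prob μ δ (E ∩ E') := by
  classical
  have mono : ∀ E : Set (Set (ℤ × ℤ)), IsUpperSet E → Monotone fun f => quenched δ f E := by
    intro E hE f f' hf
    refine measureReal_mono fun U hU => hE ?_ hU
    rintro p ⟨hp, hpU⟩
    refine ⟨hp, le_trans ?_ hpU⟩
    have := mul_le_mul_of_nonneg_left (monotone_sign (hf p)) hδ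
    simp only
    linarith
  have hI : ∀ E f, quenched δ f E ∈ Set.Icc (0 : ℝ) 1 := fun _ _ =>
    ⟨quenched_nonneg, quenched_le_one⟩
  rw [h.prob_eq, h'.prob_eq, (h.inter_union h').prob_eq]
  refine (hμ.integral_mul_le (h.measurable_quenched δ) (h'.measurable_quenched δ) (mono E hE)
    (mono E' hE') (hI E) (hI E')).trans ?_
  refine integral_mono_of_nonneg (Filter.Eventually.of_forall fun f =>
    mul_nonneg quenched_nonneg quenched_nonneg) (h.inter_union h').integrable_quenched
    (Filter.Eventually.of_forall fun f => (h.mono Finset.subset_union_left).quenched_mul_le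
      (h'.mono Finset.subset_union_right) hE hE' hδ hδ' f)

/-! ### Uniform ellipticity -/

lemma determinedBy_mem (v : Ld) : DeterminedBy {v} {A | (v : ℤ × ℤ) ∈ A} :=
  fun A B hAB => by simpa using hAB v

open Classical in
lemma DeterminedBy.quenched_inter {F F' : Finset Ld} {E E' : Set (Set (ℤ × ℤ))}
    (h : DeterminedBy F E) (h' : DeterminedBy F' E') (hF : Disjoint F F') (f : Env) :
    quenched δ f (E ∩ E') = quenched δ f E * quenched δ f E' := by
  have ind := (ProbabilityTheory.iIndepFun_infinitePi
    (P := fun _ : Ld => (volume : Measure unitInterval)) (X := fun _ x => x)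
    (fun _ => measurable_id)).indepFun_finset F F' hF (fun i => measurable_pi_apply i)
  let ext : (G : Finset Ld) → (G → unitInterval) → Ld → unitInterval :=
    fun G u v => if hv : v ∈ G then u ⟨v, hv⟩ else 0
  have hext : ∀ G, Measurable (ext G) := fun G => by
    refine measurable_pi_iff.2 fun v => ?_
    by_cases hv : v ∈ G
    · simpa [ext, hv] using measurable_pi_apply _
    · simp [ext, hv]
  have hpre : ∀ (G : Finset Ld) (D : Set (Set (ℤ × ℤ))), DeterminedBy G D →
      {U : Ld → unitInterval | arrows δ (f, U) ∈ D} =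
        (fun U (i : G) => U i) ⁻¹' (ext G ⁻¹' {U | arrows δ (f, U) ∈ D}) := by
    intro G D hD
    ext U
    refine hD _ _ fun v hv => ?_
    simp [coe_mem_arrows, ext, hv]
  have := ind.measure_inter_preimage_eq_mul _ _ (hext F (h.measurableSet_section δ f))
    (hext F' (h'.measurableSet_section δ f))
  rw [← hpre F E h, ← hpre F' E' h'] at this
  rw [quenched, quenched, quenched, measureReal_def, measureReal_def, measureReal_def,
    ← ENNReal.toReal_mul, ← this]
  rfl

lemma DeterminedBy.mul_prob_le {F F' : Finset Ld} {E E' : Set (Set (ℤ × ℤ))}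
    (h : DeterminedBy F E) (h' : DeterminedBy F' E') (hF : Disjoint F F') {c : ℝ}
    (hc : ∀ f, c ≤ quenched δ f E') : c * prob μ δ E ≤ prob μ δ (E ∩ E') := by
  classical
  rw [h.prob_eq, (h.inter_union h').prob_eq, ← integral_const_mul]
  refine integral_mono (h.integrable_quenched.const_mul c)
    (h.inter_union h').integrable_quenched fun f => ?_
  simp only
  rw [h.quenched_inter h' hF f, mul_comm]
  exact mul_le_mul_of_nonneg_left (hc f) quenched_nonneg

variable {c₀ : ℝ}

lemma jumpProb_bounds (hδ : 0 ≤ δ) (hδ' : δ < 1 / 2 - c₀) (f : Env) (v : ℤ × ℤ) :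
    c₀ ≤ jumpProb δ f v ∧ c₀ ≤ 1 - jumpProb δ f v := by
  unfold jumpProb
  rcases Real.sign_apply_eq (f v) with h | h | h <;> rw [h] <;> constructor <;> linarith

/-- Whatever happens at the other vertices, the jump from `v` goes to the right with probability
at least `c₀`. -/
lemma DeterminedBy.mul_prob_le_prob_mem {F : Finset Ld} {E : Set (Set (ℤ × ℤ))}
    (h : DeterminedBy F E) {v : Ld} (hv : v ∉ F) (hc₀ : 0 < c₀) (hδ : 0 ≤ δ)
    (hδ' : δ < 1 / 2 - c₀) :
    c₀ * prob μ δ E ≤ prob μ δ (E ∩ {A | (v : ℤ × ℤ) ∈ A}) := by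
  refine h.mul_prob_le (determinedBy_mem v) (by simpa using hv) fun f => ?_
  have := quenched_cylinder hδ (by linarith : δ ≤ 1 / 2) f (Equiv.refl _) {v} fun _ => True
  simp only [Finset.mem_singleton, forall_eq, Equiv.refl_apply, iff_true, if_true,
    Finset.prod_singleton] at this
  rw [this]
  exact (jumpProb_bounds hδ hδ' f v).1

/-- The event that all vertices in `F` jump to the left. -/
def allLeft (F : Finset Ld) : Set (Set (ℤ × ℤ)) := {A | ∀ v ∈ F, (v : ℤ × ℤ) ∉ A}

lemma determinedBy_allLeft (F : Finset Ld) : DeterminedBy F (allLeft F) :=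
  fun _ _ hAB => forall₂_congr fun v hv => not_congr (hAB v hv)

lemma le_quenched_allLeft (F : Finset Ld) (hc₀ : 0 < c₀) (hδ : 0 ≤ δ)
    (hδ' : δ < 1 / 2 - c₀) (f : Env) : c₀ ^ F.card ≤ quenched δ f (allLeft F) := by
  have := quenched_cylinder hδ (by linarith : δ ≤ 1 / 2) f (Equiv.refl _) F fun _ => False
  simp only [Equiv.refl_apply, iff_false, if_false] at this
  rw [allLeft, this, ← Finset.prod_const]
  exact Finset.prod_le_prod (fun _ _ => hc₀.le) fun v _ => (jumpProb_bounds hδ hδ' f v).2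

lemma DeterminedBy.prob_inter_compl_allLeft_le {F F' : Finset Ld} {E : Set (Set (ℤ × ℤ))}
    (h : DeterminedBy F E) (hF : Disjoint F F') (hc₀ : 0 < c₀) (hδ : 0 ≤ δ)
    (hδ' : δ < 1 / 2 - c₀) :
    prob μ δ (E ∩ (allLeft F')ᶜ) ≤ (1 - c₀ ^ F'.card) * prob μ δ E := by
  classical
  have h1 := h.mul_prob_le (μ := μ) (determinedBy_allLeft F') hF
    (le_quenched_allLeft F' hc₀ hδ hδ')
  have h2 := DeterminedBy.prob_union (μ := μ) (δ := δ) (F := F ∪ F') (E := E ∩ allLeft F')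
    (E' := E ∩ (allLeft F')ᶜ)
    (h.inter_union (determinedBy_allLeft F').compl)
    (Set.disjoint_left.2 fun _ h1 h2 => h2.2 h1.2)
  rw [Set.inter_union_compl] at h2
  linarith

end

section

/-! ### Walks on the vertices -/

/-- The space-time position after `k` steps of the walk started at the vertex `p`. -/
noncomputable def pos (A : Set (ℤ × ℤ)) (p : ℤ × ℤ) (k : ℕ) : ℤ × ℤ := (next A)^[k] p

/-- The set of arrows of the walk that is forced to the left at all vertices strictly to the right
of the column `m`. -/
def restrictArrows (m : ℤ) (A : Set (ℤ × ℤ)) : Set (ℤ × ℤ) := {p | p ∈ A ∧ p.1 ≤ m}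

variable {A B : Set (ℤ × ℤ)} {p q : ℤ × ℤ} {l m n : ℤ} {k N : ℕ}

@[simp] lemma pos_zero : pos A p 0 = p := rfl

lemma pos_succ : pos A p (k + 1) = next A (pos A p k) := Function.iterate_succ_apply' _ _ _

lemma pos_add (j : ℕ) : pos A p (j + k) = pos A (pos A p j) k := by
  rw [pos, add_comm, Function.iterate_add_apply]
  rfl

lemma next_fst_of_mem (h : p ∈ A) : (next A p).1 = p.1 + 1 := by simp [next, h]

lemma next_fst_of_notMem (h : p ∉ A) : (next A p).1 = p.1 - 1 := by simp [next, h]; ring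

lemma next_fst : (next A p).1 = p.1 + 1 ∨ (next A p).1 = p.1 - 1 := by
  by_cases h : p ∈ A
  · exact Or.inl (next_fst_of_mem h)
  · exact Or.inr (next_fst_of_notMem h)

@[simp] lemma pos_snd : (pos A p k).2 = p.2 + k := by
  induction k with
  | zero => simp
  | succ k ih =>
    rw [pos_succ]
    simp only [next, ih]
    push_cast
    ring

lemma next_mem_Ld (hp : p ∈ Ld) : next A p ∈ Ld := by
  have h := next_fst (A := A) (p := p)
  have h' : (next A p).2 = p.2 + 1 := rfl
  simp only [Ld, Set.mem_ofPred_eq, Int.even_iff, Int.odd_iff] at *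
  omega

lemma pos_mem_Ld (hp : p ∈ Ld) : pos A p k ∈ Ld := by
  induction k with
  | zero => exact hp
  | succ k ih => rw [pos_succ]; exact next_mem_Ld ih

/-- The order of two walks is preserved: on `𝕃_d` they cannot cross without meeting. -/
lemma pos_mono (hAB : A ⊆ B) (hp : p ∈ Ld) (hq : q ∈ Ld) (h2 : p.2 = q.2) (h1 : p.1 ≤ q.1) :
    (pos A p k).1 ≤ (pos B q k).1 := by
  induction k with
  | zero => exact h1
  | succ k ih =>
    have hp' := pos_mem_Ld (A := A) (k := k) hp
    have hq' := pos_mem_Ld (A := B) (k := k) hq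
    have hs : (pos A p k).2 = (pos B q k).2 := by simp [h2]
    rw [pos_succ, pos_succ]
    rcases ih.eq_or_lt with he | hlt
    · by_cases hA : pos A p k ∈ A
      · have hB : pos B q k ∈ B := by
          rw [← Prod.ext he hs]
          exact hAB hA
        rw [next_fst_of_mem hA, next_fst_of_mem hB, he]
      · rw [next_fst_of_notMem hA]
        rcases next_fst (A := B) (p := pos B q k) with h | h <;> omega
    · have hA := next_fst (A := A) (p := pos A p k)
      have hB := next_fst (A := B) (p := pos B q k)
      simp only [Ld, Set.mem_ofPred_eq, Int.even_iff, Int.odd_iff] at hp' hq'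
      omega

lemma pos_congr (h : ∀ j < k, (pos A p j ∈ A ↔ pos A p j ∈ B)) : pos A p k = pos B p k := by
  induction k with
  | zero => rfl
  | succ k ih =>
    have ih' := ih fun j hj => h j (by omega)
    rw [pos_succ, pos_succ, ← ih']
    have := h k (by omega)
    by_cases hA : pos A p k ∈ A
    · simp only [next, hA, this.1 hA]
    · simp only [next, hA, mt this.2 hA]

lemma restrictArrows_mono (hm : l ≤ m) (hAB : A ⊆ B) :
    restrictArrows l A ⊆ restrictArrows m B :=
  fun _ hp => ⟨hAB hp.1, hp.2.trans hm⟩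

lemma restrictArrows_restrictArrows (hm : l ≤ m) :
    restrictArrows l (restrictArrows m A) = restrictArrows l A := by
  ext p
  exact ⟨fun h => ⟨h.1.1, h.2⟩, fun h => ⟨⟨h.1, h.2.trans hm⟩, h.2⟩⟩

lemma pos_restrictArrows_le (hp : p.1 ≤ m + 1) : (pos (restrictArrows m A) p k).1 ≤ m + 1 := by
  induction k with
  | zero => exact hp
  | succ k ih =>
    rw [pos_succ]
    by_cases h : pos (restrictArrows m A) p k ∈ restrictArrows m A
    · rw [next_fst_of_mem h]
      have := h.2
      omega
    · rw [next_fst_of_notMem h]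
      omega

lemma pos_restrictArrows_eq (h : ∀ j < k, (pos A p j).1 ≤ m) :
    pos (restrictArrows m A) p k = pos A p k :=
  (pos_congr (B := restrictArrows m A) fun j hj => ⟨fun hA => ⟨hA, h j hj⟩, fun hA => hA.1⟩).symm

lemma pos_fst_le : (pos A p k).1 ≤ p.1 + k := by
  induction k with
  | zero => simp
  | succ k ih =>
    have := next_fst (A := A) (p := pos A p k)
    rw [pos_succ]
    push_cast
    omega

/-! ### Crossings by walks on the vertices -/

/-- The discrete vertical crossing event: some walk that starts at time `n` and is reflected on the
right of the column `m` stays weakly to the right of the column `l` for `N` steps. The reflection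
allows the walk to visit the column `m + 1`, from which it is sent back to the left. -/
def vertical (l m n : ℤ) (N : ℕ) : Set (Set (ℤ × ℤ)) :=
  {A | ∃ p ∈ Ld, p.2 = n ∧ p.1 ≤ m + 1 ∧ ∀ k ≤ N, l ≤ (pos (restrictArrows m A) p k).1}

/-- The discrete horizontal crossing event: some walk starts on the column `l` during the time
interval `[a, b]`, stays weakly to the right of `l`, and is on the column `m + 1` at some time of
the interval `[c, d]`. The walk is reflected at its target, which makes the event increasing. -/
def horizontal (l m a b c d : ℤ) : Set (Set (ℤ × ℤ)) :=
  {A | ∃ p ∈ Ld, p.1 = l ∧ a ≤ p.2 ∧ p.2 ≤ b ∧ ∃ k : ℕ, c ≤ p.2 + k ∧ p.2 + k ≤ d ∧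
    m + 1 ≤ (pos (restrictArrows m A) p k).1 ∧ ∀ j ≤ k, l ≤ (pos (restrictArrows m A) p j).1}

lemma isUpperSet_vertical : IsUpperSet (vertical l m n N) := by
  rintro A B hAB ⟨p, hp, h2, h1, h⟩
  exact ⟨p, hp, h2, h1, fun k hk => (h k hk).trans
    (pos_mono (restrictArrows_mono le_rfl hAB) hp hp rfl le_rfl)⟩

lemma isUpperSet_horizontal {a b c d : ℤ} : IsUpperSet (horizontal l m a b c d) := by
  rintro A B hAB ⟨p, hp, h1, ha, hb, k, hc, hd, hk, h⟩
  have mono : ∀ j, (pos (restrictArrows m A) p j).1 ≤ (pos (restrictArrows m B) p j).1 :=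
    fun j => pos_mono (restrictArrows_mono le_rfl hAB) hp hp rfl le_rfl
  exact ⟨p, hp, h1, ha, hb, k, hc, hd, hk.trans (mono k), fun j hj => (h j hj).trans (mono j)⟩

lemma vertical_mono {l' m' n' : ℤ} {N' : ℕ} (hl : l' ≤ l) (hm : m ≤ m') (hn : n ≤ n')
    (hN : n' + N' ≤ n + N) (hA : A ∈ vertical l m n N) : A ∈ vertical l' m' n' N' := by
  obtain ⟨p, hp, h2, h1, h⟩ := hA
  obtain ⟨i, rfl⟩ := Int.le.dest hn
  refine ⟨pos (restrictArrows m A) p i, pos_mem_Ld hp, by simp [h2],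
    (pos_restrictArrows_le h1).trans (by omega), fun k hk => ?_⟩
  refine hl.trans ((h (i + k) (by omega)).trans ?_)
  rw [pos_add]
  exact pos_mono (restrictArrows_mono hm le_rfl) (pos_mem_Ld hp) (pos_mem_Ld hp) rfl le_rfl

lemma horizontal_mono {a b c d a' b' c' d' : ℤ} (ha : a' ≤ a) (hb : b ≤ b') (hc : c' ≤ c)
    (hd : d ≤ d') (hA : A ∈ horizontal l m a b c d) : A ∈ horizontal l m a' b' c' d' := by
  obtain ⟨p, hp, h1, h2, h3, k, h4, h5, h6⟩ := hA
  exact ⟨p, hp, h1, by omega, by omega, k, by omega, by omega, h6⟩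

/-- A walk that goes from the left of `l` to the right of `m` makes a horizontal crossing between
its last visit to `l` and its first subsequent visit to `m + 1`. -/
lemma mem_horizontal_of_hit (hlm : l ≤ m) (hp : p ∈ Ld) (hpl : p.1 ≤ l)
    (hk : m + 1 ≤ (pos A p k).1) :
    A ∈ horizontal l m p.2 (p.2 + k) p.2 (p.2 + k) := by
  induction k using Nat.strong_induction_on generalizing p with
  | _ k ih =>
    by_cases hret : ∃ j, 0 < j ∧ j ≤ k ∧ (pos A p j).1 ≤ l
    · obtain ⟨j, hj0, hjk, hj⟩ := hret
      have := ih (k - j) (by omega) (pos_mem_Ld hp) hj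
        (by rw [← pos_add]; rwa [Nat.add_sub_cancel' hjk])
      rw [pos_snd] at this
      exact horizontal_mono (by omega) (by omega) (by omega) (by omega) this
    · push Not at hret
      have hex : ∃ i, m + 1 ≤ (pos A p i).1 := ⟨k, hk⟩
      classical
      let i := Nat.find hex
      have hi : m + 1 ≤ (pos A p i).1 := Nat.find_spec hex
      have hik : i ≤ k := Nat.find_min' hex hk
      have hmin : ∀ j < i, (pos A p j).1 ≤ m := fun j hj => by
        have := Nat.find_min hex hj
        omega
      have heq : ∀ j ≤ i, pos (restrictArrows m A) p j = pos A p j := fun j hj =>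
        pos_restrictArrows_eq fun j' hj' => hmin j' (by omega)
      have hi0 : 0 < i := by
        rcases Nat.eq_zero_or_pos i with h0 | h0
        · rw [h0, pos_zero] at hi
          omega
        · exact h0
      have hpl' : p.1 = l := by
        have h1 := hret 1 one_pos (by omega)
        have := next_fst (A := A) (p := p)
        rw [show pos A p 1 = next A p from rfl] at h1
        omega
      refine ⟨p, hp, hpl', le_rfl, by omega, i, by omega, by omega, by rw [heq i le_rfl]; exact hi,
        fun j hj => ?_⟩
      rw [heq j hj]
      rcases Nat.eq_zero_or_pos j with rfl | h0
      · simp [hpl']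
      · exact (hret j h0 (by omega)).le

lemma horizontal_shrink {l' m' a b c d : ℤ} (hl : l ≤ l') (hlm : l' ≤ m') (hm : m' ≤ m)
    (hA : A ∈ horizontal l m a b c d) : A ∈ horizontal l' m' a d a d := by
  obtain ⟨p, hp, h1, h2, h3, k, h4, h5, h6, h7⟩ := hA
  obtain ⟨q, hq⟩ := horizontal_mono (a' := a) (b' := d) (c' := a) (d' := d) (by omega) (by omega)
    (by omega) (by omega) (mem_horizontal_of_hit hlm hp (by omega)
      (by omega : m' + 1 ≤ (pos (restrictArrows m A) p k).1))
  rw [restrictArrows_restrictArrows hm] at hq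
  exact ⟨q, hq⟩

/-- A vertical crossing can be continued: a horizontal crossing that starts while the vertical
crossing is under way pushes it to the right side of the strip, where it meets the next vertical
crossing. -/
lemma mem_vertical_of_horizontal {a c d n' : ℤ} {N' N'' : ℕ} (hV : A ∈ vertical l m n N)
    (hH : A ∈ horizontal l m a (n + N) c d) (hV' : A ∈ vertical l m n' N') (ha : n ≤ a)
    (hc : n' ≤ c) (hN : n + N'' ≤ n' + N') : A ∈ vertical l m n N'' := by
  obtain ⟨g, hg, hg2, hg1, hgl⟩ := hV
  obtain ⟨p, hp, hp1, hpa, hpb, k, hkc, hkd, hk, hpl⟩ := hH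
  obtain ⟨g', hg', hg2', hg1', hgl'⟩ := hV'
  set R := restrictArrows m A with hR
  obtain ⟨i, hi⟩ := Int.le.dest (ha.trans hpa)
  obtain ⟨i', hi'⟩ := Int.le.dest (hc.trans hkc)
  have hiN : i ≤ N := by omega
  have h1 : ∀ j, (pos R p j).1 ≤ (pos R g (i + j)).1 := fun j => by
    rw [pos_add]
    refine pos_mono subset_rfl hp (pos_mem_Ld hg) ?_ ?_
    · rw [pos_snd]; omega
    · rw [hp1]; exact hgl i hiN
  have h2 : ∀ j, (pos R g' (i' + j)).1 ≤ (pos R g (i + k + j)).1 := fun j => by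
    rw [pos_add, pos_add (i + k)]
    refine pos_mono subset_rfl (pos_mem_Ld hg') (pos_mem_Ld hg) ?_ ?_
    · rw [pos_snd, pos_snd]; push_cast; omega
    · exact (pos_restrictArrows_le hg1').trans (hk.trans (h1 k))
  refine ⟨g, hg, hg2, hg1, fun s hs => ?_⟩
  rcases le_total s i with hsi | hsi
  · exact hgl s (hsi.trans hiN)
  · obtain ⟨j, rfl⟩ := Nat.exists_eq_add_of_le hsi
    rcases le_total j k with hjk | hjk
    · exact (hpl j hjk).trans (h1 j)
    · obtain ⟨t, rfl⟩ := Nat.exists_eq_add_of_le hjk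
      rw [← add_assoc]
      exact (hgl' (i' + t) (by omega)).trans (h2 t)

/-! ### Duality -/

lemma pos_mirror (hp : p ∈ Ld) :
    pos (mirror A) (-p.1, p.2) k = (-(pos A p k).1, (pos A p k).2) := by
  induction k with
  | zero => rfl
  | succ k ih =>
    rw [pos_succ, pos_succ, ih]
    have hq := pos_mem_Ld (A := A) (k := k) hp
    have hmem : (-(pos A p k).1, (pos A p k).2) ∈ mirror A ↔ pos A p k ∉ A := by
      simp only [mirror, Set.mem_ofPred_eq, mirror_mem_Ld, hq, true_and, neg_neg]
    by_cases h : pos A p k ∈ A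
    · simp only [next, hmem, h, not_true, if_true, if_false]
      ext <;> simp; ring
    · simp only [next, hmem, h, not_false_iff, if_true, if_false]
      ext <;> simp; ring

lemma exists_crossing_to_left (hp : p ∈ Ld) (hpm : m ≤ p.1)
    (hk : (pos (restrictArrows m A) p k).1 < l) :
    ∃ q ∈ Ld, m ≤ q.1 ∧ p.2 ≤ q.2 ∧ ∃ j : ℕ, q.2 + j ≤ p.2 + k ∧ (pos A q j).1 < l := by
  induction k using Nat.strong_induction_on generalizing p with
  | _ k ih =>
    by_cases h : ∃ i < k, m < (pos (restrictArrows m A) p i).1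
    · obtain ⟨i, hik, hi⟩ := h
      have hnext : (pos (restrictArrows m A) p (i + 1)).1 =
          (pos (restrictArrows m A) p i).1 - 1 := by
        rw [pos_succ]
        exact next_fst_of_notMem fun hmem => absurd hmem.2 (by omega)
      obtain ⟨q, hq, h1, h2, j, hj, hj'⟩ := ih (k - (i + 1)) (by omega)
        (p := pos (restrictArrows m A) p (i + 1)) (pos_mem_Ld hp) (by omega)
        (by rw [← pos_add, Nat.add_sub_cancel' hik]; exact hk)
      rw [pos_snd] at h2 hj
      exact ⟨q, hq, h1, by omega, j, by omega, hj'⟩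
    · push Not at h
      refine ⟨p, hp, hpm, le_rfl, k, le_rfl, ?_⟩
      have e : pos (restrictArrows m A) p k = pos A p k :=
        pos_congr fun j hj => ⟨fun hA => hA.1, fun hA => ⟨hA, h j hj⟩⟩
      rwa [← e]

/-- Duality: without a vertical crossing, the reflected walk makes a crossing to the left after its
last visit to the right side, and this is a horizontal crossing in the mirror. -/
lemma mirror_mem_horizontal (hlm : l ≤ m) (hA : A ∉ vertical l m n N) :
    mirror A ∈ horizontal (-m) (-l) n (n + N) n (n + N) := by
  obtain ⟨p, hp, h2, hm, hm'⟩ : ∃ p ∈ Ld, p.2 = n ∧ m ≤ p.1 ∧ p.1 ≤ m + 1 := by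
    by_cases h : (m, n) ∈ Ld
    · exact ⟨_, h, rfl, le_rfl, by simp⟩
    · refine ⟨(m + 1, n), ?_, rfl, by simp, le_rfl⟩
      simp only [Ld, Set.mem_ofPred_eq, Int.even_iff, Int.odd_iff] at *
      omega
  have : ∃ k ≤ N, (pos (restrictArrows m A) p k).1 < l := by
    by_contra hcon
    push Not at hcon
    exact hA ⟨p, hp, h2, hm', hcon⟩
  obtain ⟨k, hkN, hk⟩ := this
  obtain ⟨q, hq, hq1, hq2, j, hj, hjl⟩ := exists_crossing_to_left hp hm hk
  have := mem_horizontal_of_hit (A := mirror A) (p := (-q.1, q.2)) (k := j) (l := -m) (m := -l)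
    (by omega) (mirror_mem_Ld.2 hq) (by simpa using hq1) (by rw [pos_mirror hq]; simp only; omega)
  exact horizontal_mono (by simp only; omega) (by simp only; omega) (by simp only; omega)
    (by simp only; omega) this

/-! ### Locality and translations -/

open Classical in
/-- The vertices of `𝕃_d` in the columns from `l` to `m` and with times from `a` to `b - 1`. -/
noncomputable def rect (l m a b : ℤ) : Finset Ld :=
  (Finset.Icc l m ×ˢ Finset.Ico a b).subtype (· ∈ Ld)

lemma mem_rect {a b : ℤ} {v : Ld} :
    v ∈ rect l m a b ↔ (l ≤ v.1.1 ∧ v.1.1 ≤ m) ∧ a ≤ v.1.2 ∧ v.1.2 < b := by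
  simp [rect]

lemma pos_eq_of_rect {a b : ℤ} (hAB : ∀ v ∈ rect l m a b, (v : ℤ × ℤ) ∈ A ↔ (v : ℤ × ℤ) ∈ B)
    (hp : p ∈ Ld) (ha : a ≤ p.2) (hb : p.2 + k ≤ b)
    (hl : ∀ j < k, l ≤ (pos (restrictArrows m A) p j).1) :
    pos (restrictArrows m A) p k = pos (restrictArrows m B) p k := by
  refine pos_congr fun j hj => ?_
  have hq := pos_mem_Ld (A := restrictArrows m A) (k := j) hp
  have h1 := hl j hj
  have h2 : (pos (restrictArrows m A) p j).2 = p.2 + j := pos_snd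
  by_cases hm : (pos (restrictArrows m A) p j).1 ≤ m
  · have := hAB ⟨_, hq⟩ (mem_rect.2 ⟨⟨h1, hm⟩, by simp only; omega, by simp only; omega⟩)
    simp only [restrictArrows, Set.mem_ofPred_eq] at this ⊢
    tauto
  · exact ⟨fun h => absurd h.2 hm, fun h => absurd h.2 hm⟩

lemma determinedBy_vertical : DeterminedBy (rect l m n (n + N)) (vertical l m n N) := by
  have key : ∀ A B : Set (ℤ × ℤ), (∀ v ∈ rect l m n (n + N), (v : ℤ × ℤ) ∈ A ↔ (v : ℤ × ℤ) ∈ B) →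
      A ∈ vertical l m n N → B ∈ vertical l m n N := by
    rintro A B hAB ⟨p, hp, h2, h1, h⟩
    refine ⟨p, hp, h2, h1, fun k hk => ?_⟩
    rw [← pos_eq_of_rect hAB hp h2.ge (by omega) fun j hj => h j (by omega)]
    exact h k hk
  exact fun A B hAB => ⟨key A B hAB, key B A fun v hv => (hAB v hv).symm⟩

lemma determinedBy_horizontal {a b c d : ℤ} :
    DeterminedBy (rect l m a d) (horizontal l m a b c d) := by
  have key : ∀ A B : Set (ℤ × ℤ), (∀ v ∈ rect l m a d, (v : ℤ × ℤ) ∈ A ↔ (v : ℤ × ℤ) ∈ B) →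
      A ∈ horizontal l m a b c d → B ∈ horizontal l m a b c d := by
    rintro A B hAB ⟨p, hp, h1, h2, h3, k, h4, h5, h6, h⟩
    have e : ∀ j ≤ k, pos (restrictArrows m A) p j = pos (restrictArrows m B) p j := fun j hj =>
      pos_eq_of_rect hAB hp h2 (by omega) fun i hi => h i (by omega)
    refine ⟨p, hp, h1, h2, h3, k, h4, h5, by rw [← e k le_rfl]; exact h6, fun j hj => ?_⟩
    rw [← e j hj]
    exact h j hj
  exact fun A B hAB => ⟨key A B hAB, key B A fun v hv => (hAB v hv).symm⟩

lemma pos_translate (z : ℤ × ℤ) : pos {p | p + z ∈ A} p k + z = pos A (p + z) k := by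
  induction k with
  | zero => rfl
  | succ k ih =>
    rw [pos_succ, pos_succ, ← ih]
    simp only [next, Set.mem_ofPred_eq]
    ext <;> simp <;> ring

lemma restrictArrows_translate (z : ℤ × ℤ) :
    restrictArrows m {p | p + z ∈ A} = {p | p + z ∈ restrictArrows (m + z.1) A} := by
  ext p
  simp [restrictArrows]

lemma pos_restrictArrows_translate (z : ℤ × ℤ) :
    (pos (restrictArrows m {p | p + z ∈ A}) p k).1 + z.1 =
      (pos (restrictArrows (m + z.1) A) (p + z) k).1 := by
  rw [restrictArrows_translate, ← pos_translate]
  rfl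

lemma neg_mem_Ld {z : ℤ × ℤ} (hz : z ∈ Ld) : -z ∈ Ld := by
  simp only [Ld, Set.mem_ofPred_eq, Prod.fst_neg, Prod.snd_neg, Int.even_iff, Int.odd_iff] at *
  omega

section Law

variable {μ : Measure Env} [IsProbabilityMeasure μ] {δ : ℝ}

lemma prob_vertical_translate (hμ : TranslationInvariant μ) (hδ : 0 ≤ δ) (hδ' : δ ≤ 1 / 2)
    {z : ℤ × ℤ} (hz : z ∈ Ld) :
    prob μ δ (vertical l m n N) = prob μ δ (vertical (l + z.1) (m + z.1) (n + z.2) N) := by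
  have key : ∀ (l m n : ℤ) (z : ℤ × ℤ), z ∈ Ld →
      prob μ δ (vertical l m n N) ≤ prob μ δ (vertical (l + z.1) (m + z.1) (n + z.2) N) := by
    intro l m n z hz
    rw [← determinedBy_vertical.prob_translate hμ hδ hδ' hz]
    refine prob_mono fun A _ => ?_
    rintro ⟨p, hp, h2, h1, h⟩
    refine ⟨p + z, (add_mem_Ld hz).2 hp, by simp [h2], by simp; omega, fun k hk => ?_⟩
    rw [← pos_restrictArrows_translate]
    have := h k hk
    omega
  refine le_antisymm (key l m n z hz) ?_
  have hz' := neg_mem_Ld hz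
  simpa using key (l + z.1) (m + z.1) (n + z.2) (-z) hz'

lemma prob_horizontal_translate {a b c d : ℤ} (hμ : TranslationInvariant μ) (hδ : 0 ≤ δ)
    (hδ' : δ ≤ 1 / 2) {z : ℤ × ℤ} (hz : z ∈ Ld) :
    prob μ δ (horizontal l m a b c d) =
      prob μ δ (horizontal (l + z.1) (m + z.1) (a + z.2) (b + z.2) (c + z.2) (d + z.2)) := by
  have key : ∀ (l m a b c d : ℤ) (z : ℤ × ℤ), z ∈ Ld → prob μ δ (horizontal l m a b c d) ≤
      prob μ δ (horizontal (l + z.1) (m + z.1) (a + z.2) (b + z.2) (c + z.2) (d + z.2)) := by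
    intro l m a b c d z hz
    rw [← determinedBy_horizontal.prob_translate hμ hδ hδ' hz]
    refine prob_mono fun A _ => ?_
    rintro ⟨p, hp, h1, h2, h3, k, h4, h5, h6, h⟩
    refine ⟨p + z, (add_mem_Ld hz).2 hp, by simp [h1], by simp; omega, by simp; omega, k,
      by simp; omega, by simp; omega, ?_, fun j hj => ?_⟩
    · rw [← pos_restrictArrows_translate]
      omega
    · rw [← pos_restrictArrows_translate]
      have := h j hj
      omega
  refine le_antisymm (key l m a b c d z hz) ?_
  have hz' := neg_mem_Ld hz
  simpa using key (l + z.1) (m + z.1) (a + z.2) (b + z.2) (c + z.2) (d + z.2) (-z) hz'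

/-- Duality for the probabilities of crossing. -/
lemma one_le_prob_add_prob (hμ : ReflectionInvariant μ) (hδ : 0 ≤ δ) (hδ' : δ ≤ 1 / 2)
    (hlm : l ≤ m) :
    1 ≤ prob μ δ (vertical l m n N) + prob μ δ (horizontal (-m) (-l) n (n + N) n (n + N)) := by
  rw [← determinedBy_horizontal.prob_mirror hμ hδ hδ']
  have h := (determinedBy_vertical (l := l) (m := m) (n := n) (N := N)).prob_compl (μ := μ) (δ := δ)
  have := prob_mono (μ := μ) (δ := δ) (E := (vertical l m n N)ᶜ)
    (E' := {A | mirror A ∈ horizontal (-m) (-l) n (n + N) n (n + N)})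
    fun A _ hA => mirror_mem_horizontal hlm hA
  linarith

end Law

end

section

variable {μ : Measure Env} [IsProbabilityMeasure μ] {δ c₀ : ℝ} {l m a : ℤ}

/-! ### Widening a horizontal crossing -/

/-- The event that column `m + 1` is reached for the first time at time `a + i` by the walks that
start on the column `l` from time `a` on. -/
def firstHit (l m a : ℤ) (i : ℕ) : Set (Set (ℤ × ℤ)) :=
  horizontal l m a (a + i) a (a + i) ∩ (horizontal l m a (a + i - 1) a (a + i - 1))ᶜ

lemma determinedBy_firstHit (i : ℕ) : DeterminedBy (rect l m a (a + i)) (firstHit l m a i) :=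
  determinedBy_horizontal.inter (determinedBy_horizontal.compl.mono fun v => by
    simp only [mem_rect]
    omega)

lemma firstHit_spec {i : ℕ} {A : Set (ℤ × ℤ)} (hlm : l ≤ m + 1) (hA : A ∈ firstHit l m a i) :
    ∃ p ∈ Ld, p.1 = l ∧ a ≤ p.2 ∧ ∃ k : ℕ, pos A p k = (m + 1, a + i) ∧
      (∀ j ≤ k, l ≤ (pos A p j).1) ∧ ∀ j < k, (pos A p j).1 ≤ m := by
  obtain ⟨⟨p, hp, h1, h2, h3, k, h4, h5, h6, h7⟩, hn⟩ := hA
  have hk : p.2 + k = a + i := by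
    by_contra hne
    exact hn ⟨p, hp, h1, h2, by omega, k, by omega, by omega, h6, h7⟩
  have hlt : ∀ j < k, (pos (restrictArrows m A) p j).1 ≤ m := by
    intro j hj
    by_contra hcon
    exact hn ⟨p, hp, h1, h2, by omega, j, by omega, by omega, by omega,
      fun j' hj' => h7 j' (by omega)⟩
  have e : ∀ j ≤ k, pos (restrictArrows m A) p j = pos A p j := fun j hj =>
    pos_congr fun j' hj' => ⟨fun h => h.1, fun h => ⟨h, hlt j' (by omega)⟩⟩
  refine ⟨p, hp, h1, h2, k, ?_, fun j hj => ?_, fun j hj => ?_⟩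
  · rw [← e k le_rfl]
    exact Prod.ext (le_antisymm (pos_restrictArrows_le (by omega)) h6) (by simp [hk])
  · rw [← e j hj]
    exact h7 j hj
  · rw [← e j hj.le]
    exact hlt j hj

/-- A crossing can be widened by one column at the price of a factor `c₀`: the arrow at the vertex
where the crossing is completed for the first time is independent of the arrows before that time. -/
lemma mul_prob_horizontal_le (hlm : l ≤ m + 1) (hc₀ : 0 < c₀) (hδ : 0 ≤ δ) (hδ' : δ < 1 / 2 - c₀)
    (N : ℕ) :
    c₀ * prob μ δ (horizontal l m a (a + N) a (a + N)) ≤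
      prob μ δ (horizontal l (m + 1) a (a + (N + 1 : ℕ)) a (a + (N + 1 : ℕ))) := by
  let Q : ℕ → Set (Set (ℤ × ℤ)) :=
    fun n => {A | ∃ i < n, A ∈ firstHit l m a i ∧ (m + 1, a + (i : ℤ)) ∈ A}
  have hQ : ∀ n : ℕ,
      c₀ * prob μ δ (horizontal l m a (a + n - 1) a (a + n - 1)) ≤ prob μ δ (Q n) := by
    intro n
    induction n with
    | zero =>
      have : horizontal l m a (a + (0 : ℕ) - 1) a (a + (0 : ℕ) - 1) = ∅ := by
        refine Set.eq_empty_of_forall_notMem ?_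
        rintro A ⟨p, -, -, h2, h3, -⟩
        push_cast at h3
        omega
      rw [this]
      simp [prob]
    | succ n ih =>
      have h1 : prob μ δ (horizontal l m a (a + (n + 1 : ℕ) - 1) a (a + (n + 1 : ℕ) - 1)) ≤
          prob μ δ (horizontal l m a (a + n - 1) a (a + n - 1)) + prob μ δ (firstHit l m a n) := by
        refine le_trans (prob_mono fun A _ hA => ?_) (prob_union_le _ _)
        rw [show a + ((n + 1 : ℕ) : ℤ) - 1 = a + n by push_cast; ring] at hA
        by_cases h : A ∈ horizontal l m a (a + n - 1) a (a + n - 1)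
        · exact Or.inl h
        · exact Or.inr ⟨hA, h⟩
      have hmono : ∀ A, A ∈ Q n → A ∈ Q (n + 1) := fun A ⟨i, hi, h⟩ => ⟨i, by omega, h⟩
      by_cases hv : (m + 1, a + (n : ℤ)) ∈ Ld
      · let v : Ld := ⟨_, hv⟩
        have hvF : v ∉ rect l m a (a + n) := by
          rw [mem_rect]
          simp [v]
        have h2 := (determinedBy_firstHit (l := l) (m := m) (a := a) n).mul_prob_le_prob_mem
          (μ := μ) hvF hc₀ hδ hδ'
        classical
        have h3 := DeterminedBy.prob_union (μ := μ) (δ := δ) (F := rect l m a (a + n) ∪ {v})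
          (E := Q n) (E' := firstHit l m a n ∩ {A | (v : ℤ × ℤ) ∈ A})
          ((determinedBy_firstHit n).inter_union (determinedBy_mem v))
          (Set.disjoint_left.2 fun A ⟨i, hi, hA, _⟩ hA' => hA'.1.2
            (horizontal_mono le_rfl (by omega) le_rfl (by omega) hA.1))
        have h4 : prob μ δ (Q n ∪ firstHit l m a n ∩ {A | (v : ℤ × ℤ) ∈ A}) ≤
            prob μ δ (Q (n + 1)) := prob_mono fun A _ hA => by
          rcases hA with hA | hA
          · exact hmono A hA
          · exact ⟨n, by omega, hA⟩
        nlinarith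
      · have h0 : prob μ δ (firstHit l m a n) ≤ prob μ δ ∅ := by
          refine prob_mono fun A _ hA => ?_
          obtain ⟨p, hp, -, -, k, hk, -⟩ := firstHit_spec hlm hA
          exact absurd (hk ▸ pos_mem_Ld hp) hv
        have h5 : prob μ δ (∅ : Set (Set (ℤ × ℤ))) = 0 := by simp [prob]
        have h4 : prob μ δ (Q n) ≤ prob μ δ (Q (n + 1)) := prob_mono fun A _ hA => hmono A hA
        nlinarith
  have hN := hQ (N + 1)
  rw [show a + ((N + 1 : ℕ) : ℤ) - 1 = a + N by push_cast; ring] at hN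
  refine hN.trans (prob_mono fun A _ hA => ?_)
  obtain ⟨i, hi, hA, hmem⟩ := hA
  obtain ⟨p, hp, h1, h2, k, hk, hkl, hkm⟩ := firstHit_spec hlm hA
  have e : ∀ j ≤ k, pos (restrictArrows (m + 1) A) p j = pos A p j := fun j hj =>
    pos_restrictArrows_eq fun j' hj' => (hkm j' (by omega)).trans (by omega)
  have ht : p.2 + k = a + i := by
    have := congrArg Prod.snd hk
    simpa using this
  have hend : (pos (restrictArrows (m + 1) A) p (k + 1)).1 = m + 1 + 1 := by
    rw [pos_succ, e k le_rfl, hk]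
    exact next_fst_of_mem ⟨hmem, le_rfl⟩
  refine ⟨p, hp, h1, h2, by push_cast; omega, k + 1, by push_cast; omega, by push_cast; omega,
    hend.ge, fun j hj => ?_⟩
  rcases Nat.lt_or_ge k j with hkj | hkj
  · rw [show j = k + 1 by omega, hend]
    omega
  · rw [e j hkj]
    exact hkl j hkj

lemma pow_mul_prob_horizontal_le (hlm : l ≤ m + 1) (hc₀ : 0 < c₀) (hδ : 0 ≤ δ)
    (hδ' : δ < 1 / 2 - c₀) (N i : ℕ) :
    c₀ ^ i * prob μ δ (horizontal l m a (a + N) a (a + N)) ≤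
      prob μ δ (horizontal l (m + i) a (a + (N + i : ℕ)) a (a + (N + i : ℕ))) := by
  induction i with
  | zero => simp
  | succ i ih =>
    have := mul_prob_horizontal_le (μ := μ) (l := l) (m := m + i) (a := a) (by omega) hc₀ hδ hδ'
      (N + i)
    rw [show m + ((i + 1 : ℕ) : ℤ) = m + i + 1 by push_cast; ring, ← add_assoc]
    refine le_trans ?_ this
    rw [pow_succ, mul_comm (c₀ ^ i), mul_assoc]
    exact mul_le_mul_of_nonneg_left ih hc₀.le

/-! ### A narrow strip is left quickly -/

lemma card_rect_le : (rect 0 3 a (a + 5)).card ≤ 20 := by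
  classical
  rw [rect, Finset.card_subtype]
  refine (Finset.card_filter_le _ _).trans ?_
  simp

lemma prob_vertical_strip_le (hc₀ : 0 < c₀) (hc₀' : c₀ < 1 / 2) (hδ : 0 ≤ δ)
    (hδ' : δ < 1 / 2 - c₀) (k : ℕ) :
    prob μ δ (vertical 0 3 0 (5 * k)) ≤ (1 - c₀ ^ 20) ^ k := by
  let S : ℕ → Set (Set (ℤ × ℤ)) :=
    fun k => {A | ∀ i < k, A ∉ allLeft (rect 0 3 (5 * i : ℕ) ((5 * i : ℕ) + 5))}
  have hdet : ∀ k : ℕ, DeterminedBy (rect 0 3 0 (5 * k : ℕ)) (S k) := by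
    intro k A B hAB
    refine forall₂_congr fun i hi => not_congr (determinedBy_allLeft _ A B fun v hv => hAB v ?_)
    rw [mem_rect] at hv ⊢
    push_cast at hv ⊢
    omega
  have hpow : c₀ ^ 20 ≤ 1 := pow_le_one₀ hc₀.le (by linarith)
  have hS : ∀ k, prob μ δ (S k) ≤ (1 - c₀ ^ 20) ^ k := by
    intro k
    induction k with
    | zero => simpa using prob_le_one
    | succ k ih =>
      have h1 : prob μ δ (S (k + 1)) ≤
          prob μ δ (S k ∩ (allLeft (rect 0 3 (5 * k : ℕ) ((5 * k : ℕ) + 5)))ᶜ) :=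
        prob_mono fun A _ hA => ⟨fun i hi => hA i (by omega), hA k (by omega)⟩
      have h2 := (hdet k).prob_inter_compl_allLeft_le (μ := μ)
        (F' := rect 0 3 (5 * k : ℕ) ((5 * k : ℕ) + 5))
        (Finset.disjoint_left.2 fun v hv hv' => by
          rw [mem_rect] at hv hv'
          omega) hc₀ hδ hδ'
      have h3 : c₀ ^ 20 ≤ c₀ ^ (rect 0 3 (5 * k : ℕ) ((5 * k : ℕ) + 5)).card :=
        pow_le_pow_of_le_one hc₀.le (by linarith) card_rect_le
      rw [pow_succ, mul_comm]
      refine (h1.trans h2).trans ?_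
      exact mul_le_mul (by linarith) ih prob_nonneg (by linarith)
  refine (prob_mono fun A _ hA => ?_).trans (hS k)
  intro i hi hleft
  obtain ⟨p, hp, h2, h1, h⟩ := hA
  have key : ∀ j ≤ 5, (pos (restrictArrows 3 A) p (5 * i + j)).1 ≤ 4 - j := by
    intro j
    induction j with
    | zero => intro _; simpa using pos_restrictArrows_le (m := 3) h1
    | succ j ih =>
      intro hj
      have hprev := ih (by omega)
      have hge := h (5 * i + j) (by omega)
      have hnot : pos (restrictArrows 3 A) p (5 * i + j) ∉ restrictArrows 3 A := fun hmem => by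
        refine hleft ⟨_, pos_mem_Ld hp⟩ ?_ hmem.1
        rw [mem_rect]
        refine ⟨⟨hge, hmem.2⟩, ?_, ?_⟩
        · simp only [pos_snd]; push_cast; omega
        · simp only [pos_snd]; push_cast; omega
      rw [← add_assoc, pos_succ, next_fst_of_notMem hnot]
      push_cast
      omega
  have h5 := key 5 le_rfl
  have := h (5 * i + 5) (by omega)
  push_cast at h5
  omega

/-! ### Lengthening vertical crossings -/

lemma even_mem_Ld {n : ℤ} (hn : Even n) : ((0 : ℤ), n) ∈ Ld := Or.inl ⟨Even.zero, hn⟩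

/-- Cut the time interval of a horizontal crossing into two slabs. Its endpoints lie in the same
slab or in consecutive ones; one of these two types has a good probability. -/
lemma exists_slab {D : ℤ} {K M : ℕ} {η : ℝ} (hμ : TranslationInvariant μ) (hδ : 0 ≤ δ)
    (hδ' : δ ≤ 1 / 2) (hK : Even K) (hM : M ≤ 2 * K)
    (h : η ≤ prob μ δ (horizontal 0 D 0 (0 + M) 0 (0 + M))) :
    ∃ d : ℕ, Even d ∧ η / 3 ≤ prob μ δ (horizontal 0 D 0 K d (d + K)) := by
  have hu : prob μ δ (horizontal 0 D 0 (0 + M) 0 (0 + M)) ≤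
      prob μ δ (horizontal 0 D 0 K 0 K) + prob μ δ (horizontal 0 D 0 K K (K + K)) +
        prob μ δ (horizontal 0 D (0 + K) (K + K) (0 + K) (K + K)) := by
    refine le_trans (prob_mono fun A _ hA => ?_)
      ((prob_union_le _ _).trans (add_le_add (prob_union_le _ _) le_rfl))
    obtain ⟨p, hp, h1, h2, h3, k, h4, h5, h6⟩ := hA
    rcases le_total p.2 K with hs | hs
    · rcases le_total (p.2 + k) K with ht | ht
      · exact Or.inl (Or.inl ⟨p, hp, h1, h2, hs, k, h4, ht, h6⟩)
      · exact Or.inl (Or.inr ⟨p, hp, h1, h2, hs, k, ht, by omega, h6⟩)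
    · exact Or.inr ⟨p, hp, h1, by omega, by omega, k, by omega, by omega, h6⟩
  have ht := prob_horizontal_translate (μ := μ) (l := 0) (m := D) (a := 0) (b := K) (c := 0)
    (d := K) hμ hδ hδ' (even_mem_Ld ((Int.even_coe_nat K).2 hK))
  simp only [add_zero] at ht
  rw [← ht] at hu
  by_cases hc : η / 3 ≤ prob μ δ (horizontal 0 D 0 K 0 K)
  · exact ⟨0, Even.zero, by simpa using hc⟩
  · exact ⟨K, hK, by linarith⟩

lemma mul_prob_vertical_le {D : ℤ} {K G N d : ℕ} {v s : ℝ} (hμ : TranslationInvariant μ)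
    (hF : FKG μ) (hδ : 0 ≤ δ) (hδ' : δ ≤ 1 / 2) (hd : Even d) (hv : 0 ≤ v)
    (hN : Even N) (hV : v ≤ prob μ δ (vertical 0 D 0 (K + G)))
    (hH : s ≤ prob μ δ (horizontal 0 D 0 K d (d + K))) :
    prob μ δ (vertical 0 D 0 (N + K)) * (s * v) ≤ prob μ δ (vertical 0 D 0 (N + K + G)) := by
  have hz := even_mem_Ld ((Int.even_coe_nat N).2 hN)
  have hz' : ((0 : ℤ), ((N + d : ℕ) : ℤ)) ∈ Ld :=
    even_mem_Ld ((Int.even_coe_nat _).2 (hN.add hd))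
  rw [prob_horizontal_translate hμ hδ hδ' hz] at hH
  rw [prob_vertical_translate hμ hδ hδ' hz'] at hV
  simp only [add_zero] at hH hV
  classical
  have d1 := determinedBy_vertical (l := 0) (m := D) (n := 0) (N := N + K)
  have d2 := determinedBy_horizontal (l := 0) (m := D) (a := 0 + (N : ℤ)) (b := K + (N : ℤ))
    (c := d + (N : ℤ)) (d := d + K + (N : ℤ))
  have d3 := determinedBy_vertical (l := 0) (m := D) (n := 0 + ((N + d : ℕ) : ℤ)) (N := K + G)
  have i1 := d2.prob_mul_le (μ := μ) d3 isUpperSet_horizontal isUpperSet_vertical hF hδ hδ'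
  have i2 := d1.prob_mul_le (μ := μ) (d2.inter_union d3) isUpperSet_vertical
    (isUpperSet_horizontal.inter isUpperSet_vertical) hF hδ hδ'
  calc _ ≤ _ := mul_le_mul_of_nonneg_left
        ((mul_le_mul hH hV hv prob_nonneg).trans i1) prob_nonneg
    _ ≤ _ := i2
    _ ≤ _ := prob_mono fun A _ ⟨h1, h2, h3⟩ =>
        mem_vertical_of_horizontal h1
          (horizontal_mono le_rfl (by push_cast; omega) le_rfl le_rfl h2)
          h3 (by omega) (by push_cast; omega) (by push_cast; omega)

/-- Iterated lengthening of vertical crossings, in a strip of fixed width. -/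
lemma le_prob_vertical_iterate {D : ℤ} {K G M : ℕ} {v η : ℝ} (hμ : TranslationInvariant μ)
    (hF : FKG μ) (hδ : 0 ≤ δ) (hδ' : δ ≤ 1 / 2) (hK : Even K) (hG : Even G) (hM : M ≤ 2 * K)
    (hv : 0 ≤ v) (hη : 0 ≤ η) (hV : v ≤ prob μ δ (vertical 0 D 0 (K + G)))
    (hH : η ≤ prob μ δ (horizontal 0 D 0 (0 + M) 0 (0 + M))) (i : ℕ) :
    v * (η / 3 * v) ^ i ≤ prob μ δ (vertical 0 D 0 (G + i * G + K)) := by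
  obtain ⟨d, hd, hs⟩ := exists_slab hμ hδ hδ' hK hM hH
  induction i with
  | zero => simpa [add_comm] using hV
  | succ i ih =>
    have hN : Even (G + i * G) := hG.add (hG.mul_left i)
    have := mul_prob_vertical_le hμ hF hδ hδ' hd hv hN hV hs
    rw [show G + (i + 1) * G + K = G + i * G + K + G by ring]
    refine le_trans ?_ this
    rw [pow_succ, ← mul_assoc]
    exact mul_le_mul_of_nonneg_right ih (by positivity)

end

section

/-! ### Trajectories started at arbitrary points -/

lemma mem_LdPlane {x y : ℝ} :
    (x, y) ∈ LdPlane ↔ (∃ k : ℤ, x - y = 2 * k) ∧ ∃ k : ℤ, x + y = 2 * k := by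
  constructor
  · rintro ⟨p, hp, he⟩
    obtain ⟨rfl, rfl⟩ := Prod.ext_iff.1 he
    obtain ⟨⟨a, ha⟩, b, hb⟩ | ⟨⟨a, ha⟩, b, hb⟩ := hp
    · exact ⟨⟨a - b, by simp only [ha, hb]; push_cast; ring⟩,
        ⟨a + b, by simp only [ha, hb]; push_cast; ring⟩⟩
    · exact ⟨⟨a - b, by simp only [ha, hb]; push_cast; ring⟩,
        ⟨a + b + 1, by simp only [ha, hb]; push_cast; ring⟩⟩
  · rintro ⟨⟨a, ha⟩, b, hb⟩
    refine ⟨(a + b, b - a), ?_, Prod.ext ?_ ?_⟩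
    · simp only [Ld, Set.mem_ofPred_eq, Int.even_iff, Int.odd_iff]
      omega
    · simp only; push_cast; linarith
    · simp only; push_cast; linarith

lemma mem_LPlane {x y : ℝ} :
    (x, y) ∈ LPlane ↔ (∃ k : ℤ, x - y = 2 * k) ∨ ∃ k : ℤ, x + y = 2 * k := by
  constructor
  · rintro ⟨⟨x', y'⟩, hv, t, -, -, h | h⟩
    all_goals
      obtain ⟨rfl, rfl⟩ := Prod.ext_iff.1 h
      obtain ⟨⟨a, ha⟩, b, hb⟩ := mem_LdPlane.1 hv
    · exact Or.inl ⟨a, by simp only [Prod.fst_add, Prod.snd_add]; linarith⟩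
    · exact Or.inr ⟨b, by simp only [Prod.fst_add, Prod.snd_add]; linarith⟩
  · rintro (⟨a, ha⟩ | ⟨b, hb⟩)
    · refine ⟨(⌊x⌋, y - (x - ⌊x⌋)), mem_LdPlane.2 ⟨⟨a, by linarith⟩, ⟨⌊x⌋ - a, ?_⟩⟩, Int.fract x,
        Int.fract_nonneg x, Int.fract_lt_one x, Or.inl (Prod.ext ?_ ?_)⟩
      · push_cast; linarith
      · exact (Int.floor_add_fract x).symm
      · simp only [Prod.snd_add, Int.fract]; ring
    · refine ⟨(⌈x⌉, y - (⌈x⌉ - x)), mem_LdPlane.2 ⟨⟨⌈x⌉ - b, ?_⟩, ⟨b, by linarith⟩⟩, ⌈x⌉ - x,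
        by linarith [Int.le_ceil x], by linarith [Int.ceil_lt_add_one x],
        Or.inr (Prod.ext ?_ ?_)⟩
      · push_cast; linarith
      · simp
      · simp

/-- The first vertex of `𝕃_d` on the trajectory started at `v`: it is the top of the diamond that
contains `v`. -/
noncomputable def landing (v : ℝ × ℝ) : ℤ × ℤ :=
  (⌊(v.1 - v.2) / 2⌋ + ⌈(v.1 + v.2) / 2⌉, ⌈(v.1 + v.2) / 2⌉ - ⌊(v.1 - v.2) / 2⌋)

lemma landing_mem_Ld (v : ℝ × ℝ) : landing v ∈ Ld := by
  simp only [landing, Ld, Set.mem_ofPred_eq, Int.even_iff, Int.odd_iff]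
  omega

lemma landing_bounds (v : ℝ × ℝ) :
    v.1 - 1 < (landing v).1 ∧ ((landing v).1 : ℝ) < v.1 + 1 ∧ v.2 ≤ (landing v).2 ∧
      ((landing v).2 : ℝ) < v.2 + 2 := by
  have h1 := Int.floor_le ((v.1 - v.2) / 2)
  have h2 := Int.lt_floor_add_one ((v.1 - v.2) / 2)
  have h3 := Int.le_ceil ((v.1 + v.2) / 2)
  have h4 := Int.ceil_lt_add_one ((v.1 + v.2) / 2)
  simp only [landing]
  push_cast
  refine ⟨?_, ?_, ?_, ?_⟩ <;> linarith

lemma timeToL_eq (v : ℝ × ℝ) :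
    timeToL v = min (v.1 - v.2 - 2 * ⌊(v.1 - v.2) / 2⌋) (2 * ⌈(v.1 + v.2) / 2⌉ - (v.1 + v.2)) := by
  refine IsLeast.csInf_eq ⟨⟨le_min ?_ ?_, mem_LPlane.2 ?_⟩, ?_⟩
  · linarith [Int.floor_le ((v.1 - v.2) / 2)]
  · linarith [Int.le_ceil ((v.1 + v.2) / 2)]
  · rcases min_choice (v.1 - v.2 - 2 * ⌊(v.1 - v.2) / 2⌋ : ℝ)
      (2 * ⌈(v.1 + v.2) / 2⌉ - (v.1 + v.2)) with h | h <;> rw [h]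
    · exact Or.inl ⟨_, by ring⟩
    · exact Or.inr ⟨_, by ring⟩
  · rintro s ⟨hs, hmem⟩
    rcases mem_LPlane.1 hmem with ⟨k, hk⟩ | ⟨k, hk⟩
    · refine (min_le_left _ _).trans ?_
      have : (k : ℝ) ≤ ⌊(v.1 - v.2) / 2⌋ := by
        exact_mod_cast Int.le_floor.2 (by linarith : (k : ℝ) ≤ (v.1 - v.2) / 2)
      linarith
    · refine (min_le_right _ _).trans ?_
      have : (⌈(v.1 + v.2) / 2⌉ : ℝ) ≤ k := by
        exact_mod_cast Int.ceil_le.2 (by linarith : (v.1 + v.2) / 2 ≤ (k : ℝ))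
      linarith

lemma orientation_eq_one {x y : ℝ} {k : ℤ} (h : x - y = 2 * k) : orientation (x, y) = 1 := by
  have : x = y + (2 * k : ℤ) := by push_cast; linarith
  simp only [orientation, this, Int.floor_add_intCast]
  exact Even.neg_one_zpow ⟨⌊y⌋ + k, by ring⟩

lemma orientation_eq_neg_one {x y : ℝ} {k : ℤ} (h : x + y = 2 * k)
    (h' : ¬ ∃ k : ℤ, x - y = 2 * k) : orientation (x, y) = -1 := by
  have hy : y = -x + (2 * k : ℤ) := by push_cast; linarith
  have hx : (⌊x⌋ : ℝ) ≠ x := fun hx => h' ⟨⌊x⌋ - k, by push_cast; linarith⟩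
  have hc : ⌈x⌉ = ⌊x⌋ + 1 := by
    refine Int.ceil_eq_iff.2 ⟨?_, ?_⟩
    · push_cast
      linarith [lt_of_le_of_ne (Int.floor_le x) hx]
    · push_cast
      linarith [Int.lt_floor_add_one x]
  simp only [orientation, hy, Int.floor_add_intCast, Int.floor_neg, hc]
  exact Odd.neg_one_zpow ⟨k - 1, by ring⟩

/-- A trajectory moves straight up, then along an edge, and then from vertex to vertex. -/
lemma path_cases (v : ℝ × ℝ) :
    ∃ σ s : ℝ, 0 ≤ s ∧ s ≤ (landing v).2 - v.2 ∧ (σ = 1 ∨ σ = -1) ∧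
      v.1 + σ * ((landing v).2 - v.2 - s) = (landing v).1 ∧
      ∀ A t, path A v t = if t < s then v.1 else if t ≤ (landing v).2 - v.2 then v.1 + σ * (t - s)
        else vertexPath A (landing v) (t - ((landing v).2 - v.2)) := by
  have h1 := Int.floor_le ((v.1 - v.2) / 2)
  have h2 := Int.lt_floor_add_one ((v.1 - v.2) / 2)
  have h3 := Int.le_ceil ((v.1 + v.2) / 2)
  have h4 := Int.ceil_lt_add_one ((v.1 + v.2) / 2)
  have hL := timeToL_eq v
  simp only [landing]
  set a := ⌊(v.1 - v.2) / 2⌋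
  set b := ⌈(v.1 + v.2) / 2⌉
  have key : ∀ σ s : ℝ, timeToL v = s → orientation (v.1, v.2 + s) = σ →
      timeToLd (v.1, v.2 + s) = b - a - v.2 - s → v.1 + σ * (b - a - v.2 - s) = a + b →
      ∀ A t, path A v t = if t < s then v.1 else if t ≤ ((b - a : ℤ) : ℝ) - v.2 then
        v.1 + σ * (t - s) else vertexPath A (a + b, b - a) (t - (((b - a : ℤ) : ℝ) - v.2)) := by
    intro σ s hs hσ hT he A t
    rw [path, hs]
    refine if_congr Iff.rfl rfl ?_
    rw [edgePath, hT]
    simp only [hσ]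
    refine if_congr (by push_cast; constructor <;> intro <;> linarith) rfl ?_
    have e1 : ⌊v.1 + σ * (b - a - v.2 - s)⌋ = a + b := by
      rw [he]; exact_mod_cast Int.floor_intCast (a + b)
    have e2 : ⌊v.2 + s + (b - a - v.2 - s)⌋ = b - a := by
      rw [show v.2 + s + (b - a - v.2 - s) = ((b - a : ℤ) : ℝ) by push_cast; ring]
      exact Int.floor_intCast _
    rw [e1, e2]
    congr 1
    push_cast
    ring
  rcases le_or_gt (v.1 - v.2 - 2 * a) (2 * b - (v.1 + v.2)) with hle | hlt
  · rw [min_eq_left hle] at hL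
    have ho : orientation (v.1, v.2 + (v.1 - v.2 - 2 * a)) = 1 :=
      orientation_eq_one (k := a) (by ring)
    refine ⟨1, v.1 - v.2 - 2 * a, by linarith, by push_cast; linarith, Or.inl rfl,
      by push_cast; ring, key _ _ hL ho ?_ (by ring)⟩
    refine IsLeast.csInf_eq ⟨⟨by linarith, ?_⟩, ?_⟩
    · rw [ho]
      exact mem_LdPlane.2 ⟨⟨a, by simp only; ring⟩, ⟨b, by simp only; ring⟩⟩
    · rintro s ⟨hs, hmem⟩
      rw [ho] at hmem
      obtain ⟨-, k, hk⟩ := mem_LdPlane.1 hmem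
      simp only at hk
      have : (b : ℝ) ≤ k := by
        exact_mod_cast Int.ceil_le.2 (by linarith : (v.1 + v.2) / 2 ≤ (k : ℝ))
      linarith
  · rw [min_eq_right hlt.le] at hL
    have ho : orientation (v.1, v.2 + (2 * b - (v.1 + v.2))) = -1 := by
      refine orientation_eq_neg_one (k := b) (by ring) ?_
      rintro ⟨k, hk⟩
      have : (k : ℝ) ≤ a := by
        exact_mod_cast Int.le_floor.2 (by linarith : (k : ℝ) ≤ (v.1 - v.2) / 2)
      linarith
    refine ⟨-1, 2 * b - (v.1 + v.2), by linarith, by push_cast; linarith, Or.inr rfl,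
      by push_cast; ring, key _ _ hL ho ?_ (by ring)⟩
    refine IsLeast.csInf_eq ⟨⟨by linarith, ?_⟩, ?_⟩
    · rw [ho]
      exact mem_LdPlane.2 ⟨⟨a, by simp only; ring⟩, ⟨b, by simp only; ring⟩⟩
    · rintro s ⟨hs, hmem⟩
      rw [ho] at hmem
      obtain ⟨⟨k, hk⟩, -⟩ := mem_LdPlane.1 hmem
      simp only at hk
      have : (k : ℝ) ≤ a := by
        exact_mod_cast Int.le_floor.2 (by linarith : (k : ℝ) ≤ (v.1 - v.2) / 2)
      linarith

variable {A : Set (ℤ × ℤ)} {p : ℤ × ℤ} {v : ℝ × ℝ} {t : ℝ}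

lemma vertexPath_add (k : ℕ) {θ : ℝ} (h0 : 0 ≤ θ) (h1 : θ ≤ 1) :
    vertexPath A p (k + θ) =
      (pos A p k).1 + θ * ((pos A p (k + 1)).1 - (pos A p k).1) := by
  rcases h1.lt_or_eq with h | rfl
  · have hf : ⌊(k : ℝ) + θ⌋₊ = k := by
      rw [Nat.floor_eq_iff (by positivity)]
      constructor <;> linarith
    simp only [vertexPath, hf, vertexWalk, pos]
    ring
  · have hf : ⌊(k : ℝ) + 1⌋₊ = k + 1 := by exact_mod_cast Nat.floor_natCast (k + 1)
    simp only [vertexPath, hf, vertexWalk, pos]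
    push_cast
    ring

lemma vertexPath_natCast (k : ℕ) : vertexPath A p k = (pos A p k).1 := by
  simpa using vertexPath_add (A := A) (p := p) k le_rfl zero_le_one

lemma exists_floor (ht : 0 ≤ t) : ∃ (k : ℕ) (θ : ℝ), 0 ≤ θ ∧ θ < 1 ∧ t = k + θ :=
  ⟨⌊t⌋₊, t - ⌊t⌋₊, by linarith [Nat.floor_le ht], by linarith [Nat.lt_floor_add_one t], by ring⟩

/-- After its landing at a vertex, a trajectory moves from vertex to vertex. -/
lemma path_of_le (ht : (landing v).2 - v.2 ≤ t) :
    path A v t = vertexPath A (landing v) (t - ((landing v).2 - v.2)) := by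
  obtain ⟨σ, s, -, hs, -, he, h⟩ := path_cases v
  rw [h, if_neg (by linarith)]
  rcases ht.eq_or_lt with rfl | hlt
  · rw [if_pos le_rfl, he, sub_self]
    simpa using (vertexPath_natCast (A := A) (p := landing v) 0).symm
  · rw [if_neg (by linarith)]

lemma path_mem_of_le (ht : t ≤ (landing v).2 - v.2) :
    min v.1 (landing v).1 ≤ path A v t ∧ path A v t ≤ max v.1 (landing v).1 := by
  obtain ⟨σ, s, -, hs, hσ, he, h⟩ := path_cases v
  rw [h, ← he]
  split_ifs with h1
  · simp
  · rw [min_le_iff, le_max_iff]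
    rcases hσ with rfl | rfl
    · exact ⟨Or.inl (by linarith), Or.inr (by linarith)⟩
    · exact ⟨Or.inr (by linarith), Or.inl (by linarith)⟩

lemma landing_vertical {x n : ℤ} {y : ℝ} (h : (x, n) ∈ Ld) (h1 : (n : ℝ) - 2 < y) (h2 : y ≤ n) :
    landing ((x : ℝ), y) = (x, n) := by
  obtain ⟨a, ha⟩ : ∃ a : ℤ, x - n = 2 * a := ⟨(x - n) / 2, by
    simp only [Ld, Set.mem_ofPred_eq, Int.even_iff, Int.odd_iff] at h; omega⟩
  have ha' : (x : ℝ) - n = 2 * a := by exact_mod_cast ha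
  have e1 : ⌊((x : ℝ) - y) / 2⌋ = a := by
    rw [Int.floor_eq_iff]; constructor <;> linarith
  have e2 : ⌈((x : ℝ) + y) / 2⌉ = a + n := by
    rw [Int.ceil_eq_iff]; push_cast; constructor <;> linarith
  simp only [landing, e1, e2]
  ext <;> simp only <;> omega

lemma landing_edge {x n : ℤ} {r : ℝ} (h : (x, n) ∈ Ld) (h1 : 0 ≤ r) (h2 : r < 1) :
    landing (x - r, n - r) = (x, n) := by
  obtain ⟨a, ha⟩ : ∃ a : ℤ, x - n = 2 * a := ⟨(x - n) / 2, by
    simp only [Ld, Set.mem_ofPred_eq, Int.even_iff, Int.odd_iff] at h; omega⟩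
  have ha' : (x : ℝ) - n = 2 * a := by exact_mod_cast ha
  have e1 : ⌊((x : ℝ) - r - (n - r)) / 2⌋ = a := by
    rw [Int.floor_eq_iff]; constructor <;> linarith
  have e2 : ⌈((x : ℝ) - r + (n - r)) / 2⌉ = a + n := by
    rw [Int.ceil_eq_iff]; push_cast; constructor <;> linarith
  simp only [landing, e1, e2]
  ext <;> simp only <;> omega

end

section

/-! ### Comparison of crossings in the plane and on the vertices -/

variable {δ w h : ℝ} {ω : Sample} {u : ℝ × ℝ} {A : Set (ℤ × ℤ)} {p : ℤ × ℤ} {l m n : ℤ} {N : ℕ}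

lemma le_vertexPath {x t : ℝ} (hx : ∀ k ≤ N, x ≤ (pos A p k).1) (h0 : 0 ≤ t) (ht : t ≤ N) :
    x ≤ vertexPath A p t := by
  obtain ⟨k, θ, hθ, hθ', rfl⟩ := exists_floor h0
  have hk : k ≤ N := by
    have : (k : ℝ) ≤ N := by linarith
    exact_mod_cast this
  rw [vertexPath_add k hθ hθ'.le]
  have h1 := hx k hk
  rcases hk.lt_or_eq with hlt | rfl
  · have h2 := hx (k + 1) hlt
    nlinarith
  · have : θ = 0 := by linarith
    simpa [this] using h1

lemma vertexPath_le {x t : ℝ} (hx : ∀ k ≤ N, (pos A p k).1 ≤ x) (h0 : 0 ≤ t) (ht : t ≤ N) :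
    vertexPath A p t ≤ x := by
  obtain ⟨k, θ, hθ, hθ', rfl⟩ := exists_floor h0
  have hk : k ≤ N := by
    have : (k : ℝ) ≤ N := by linarith
    exact_mod_cast this
  rw [vertexPath_add k hθ hθ'.le]
  have h1 := hx k hk
  rcases hk.lt_or_eq with hlt | rfl
  · have h2 := hx (k + 1) hlt
    nlinarith
  · have : θ = 0 := by linarith
    simpa [this] using h1

lemma reflectedX_eq {a : ℝ} {v : ℝ × ℝ} {t : ℝ} :
    reflectedX δ ω a v t = min a (path (restrictArrows ⌊a⌋ (arrows δ ω)) v t) := by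
  have : {p | p ∈ arrows δ ω ∧ (p.1 : ℝ) ≤ a} = restrictArrows ⌊a⌋ (arrows δ ω) := by
    ext p
    exact and_congr_right fun _ => Int.le_floor.symm
  rw [reflectedX, this]

lemma mem_V_of_vertical (hw : 0 ≤ w) (hh : 0 ≤ h) (hN0 : 1 ≤ N) (hl : u.1 ≤ l)
    (hm : (m : ℝ) ≤ u.1 + w) (hn : u.2 ≤ n) (hn' : (n : ℝ) < u.2 + 1) (hN : u.2 + h ≤ n + N)
    (hA : arrows δ ω ∈ vertical l m n N) : ω ∈ V δ u w h := by
  set R := restrictArrows ⌊u.1 + w⌋ (arrows δ ω) with hR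
  -- A walk that starts beyond the reflecting line is replaced by its position one step later.
  obtain ⟨x, n', hx, hlx, hxm, h1, h2, hwalk⟩ : ∃ x n' : ℤ, (x, n') ∈ Ld ∧ l ≤ x ∧
      (x : ℝ) ≤ u.1 + w ∧ (n' : ℝ) - 2 < u.2 ∧ u.2 ≤ n' ∧
        ∀ k : ℕ, n' + k ≤ n + N → l ≤ (pos R (x, n') k).1 := by
    obtain ⟨⟨x, n⟩, hp, rfl, hp1, hpl⟩ := vertical_mono le_rfl (Int.le_floor.2 hm) le_rfl le_rfl hA
    by_cases hx : x ≤ ⌊u.1 + w⌋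
    · exact ⟨x, n, hp, hpl 0 (by omega), Int.le_floor.1 hx, by linarith, hn,
        fun k hk => hpl k (by simp only at hk; omega)⟩
    · have hnext : pos R (x, n) 1 = (x - 1, n + 1) := by
        refine Prod.ext ?_ (by simp)
        exact next_fst_of_notMem fun hmem => hx hmem.2
      have hl1 := hpl 1 hN0
      rw [← hR, hnext] at hl1
      refine ⟨x - 1, n + 1, ?_, hl1, ?_, by push_cast; linarith, by push_cast; linarith,
        fun k hk => ?_⟩
      · rw [← hnext]
        exact pos_mem_Ld hp
      · exact Int.le_floor.1 (by simp only at hp1; omega)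
      · rw [← hnext, ← pos_add]
        exact hpl (1 + k) (by simp only at hk; omega)
  have hlx' : (l : ℝ) ≤ x := by exact_mod_cast hlx
  have hland := landing_vertical hx h1 h2
  have hpath : ∀ s, 0 ≤ s → s ≤ h → u.1 ≤ path R ((x : ℝ), u.2) s := by
    intro s hs0 hsh
    rcases le_total s (n' - u.2) with hs | hs
    · have := (path_mem_of_le (A := R) (v := ((x : ℝ), u.2)) (t := s) (by rw [hland]; exact hs)).1
      rw [hland] at this
      simp only [min_self] at this
      linarith
    · rw [path_of_le (by rw [hland]; exact hs), hland]
      have hle : n' ≤ n + N := by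
        have : (n' : ℝ) ≤ ((n + N : ℤ) : ℝ) := by push_cast; linarith
        exact_mod_cast this
      have hM : ((n + N - n').toNat : ℝ) = n + N - n' := by
        have : ((n + N - n').toNat : ℤ) = n + N - n' := Int.toNat_of_nonneg (by omega)
        exact_mod_cast this
      refine le_vertexPath (N := (n + N - n').toNat) (fun k hk => ?_) (by simp only; linarith)
        (by rw [hM]; simp only; linarith)
      refine hl.trans ?_
      exact_mod_cast hwalk k (by omega)
  have hbox : ∀ s, 0 ≤ s → s ≤ h →
      (reflectedX δ ω (u.1 + w) ((x : ℝ), u.2) s, u.2 + s) ∈ box u w h := by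
    intro s hs0 hsh
    rw [reflectedX_eq]
    exact ⟨le_min (by linarith) (hpath s hs0 hsh), min_le_left _ _, by simp only; linarith,
      by simp only; linarith⟩
  exact ⟨((x : ℝ), u.2), ⟨⟨by simp only; linarith, hxm, le_rfl, by simp only; linarith⟩, rfl⟩, h,
    hh, ⟨hbox h hh le_rfl, rfl⟩, hbox⟩

lemma mem_vertical_of_V (hl : (l : ℝ) < u.1 + 1) (hm : u.1 + w < m + 1) (hn : u.2 + 2 ≤ n)
    (hN : n + N ≤ u.2 + h) (hω : ω ∈ V δ u w h) : arrows δ ω ∈ vertical l m n N := by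
  obtain ⟨v, ⟨⟨hv1, hv2, -, -⟩, hv⟩, t, ht, ⟨-, htop⟩, hbox⟩ := hω
  simp only [hv, add_right_inj] at htop
  subst htop
  obtain ⟨-, hp1, hp2, hp3⟩ := landing_bounds v
  set p := landing v with hp
  set R := restrictArrows ⌊u.1 + w⌋ (arrows δ ω) with hR
  have hpn : p.2 ≤ n := by
    have : (p.2 : ℝ) ≤ n := by linarith
    exact_mod_cast this
  have hM : ((n + N - p.2).toNat : ℤ) = n + N - p.2 := Int.toNat_of_nonneg (by omega)
  refine vertical_mono (l := l) (m := ⌊u.1 + w⌋) (n := p.2) (N := (n + N - p.2).toNat) le_rfl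
    (Int.lt_add_one_iff.1 (Int.floor_lt.2 (by push_cast; linarith))) hpn (by omega)
    ⟨p, landing_mem_Ld v, rfl, ?_, fun k hk => ?_⟩
  · have := Int.lt_floor_add_one (u.1 + w)
    have h2 : (p.1 : ℝ) < ((⌊u.1 + w⌋ + 2 : ℤ) : ℝ) := by push_cast; linarith
    have h3 : p.1 < ⌊u.1 + w⌋ + 2 := by exact_mod_cast h2
    omega
  · have hk' : p.2 + (k : ℝ) ≤ n + N := by
      have : p.2 + (k : ℤ) ≤ n + N := by omega
      exact_mod_cast this
    have := (hbox (p.2 - v.2 + k) (by have := k.cast_nonneg (α := ℝ); linarith) (by linarith)).1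
    rw [reflectedX_eq] at this
    have hpath := this.trans (min_le_right _ _)
    rw [path_of_le (by have := k.cast_nonneg (α := ℝ); linarith), ← hp, ← hR,
      add_sub_cancel_left, vertexPath_natCast] at hpath
    have h4 : (l : ℝ) < (((pos R p k).1 + 1 : ℤ) : ℝ) := by push_cast; linarith
    exact Int.lt_add_one_iff.1 (by exact_mod_cast h4)

lemma mem_horizontal_of_H {n' : ℤ} (hw : 1 ≤ w) (hlm : l ≤ m) (hl : u.1 ≤ l)
    (hm : (m : ℝ) + 1 ≤ u.1 + w) (hn : (n : ℝ) ≤ u.2) (hn' : u.2 + h + 1 ≤ n')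
    (hω : ω ∈ H δ u w h) : arrows δ ω ∈ horizontal l m n n' n n' := by
  obtain ⟨v, ⟨⟨-, -, hv2, -⟩, hv1⟩, t, -, ⟨⟨-, -, -, htop⟩, hright⟩, -⟩ := hω
  simp only [X] at hright htop
  obtain ⟨-, hp1, hp2, -⟩ := landing_bounds v
  set p := landing v with hp
  have ht : p.2 - v.2 ≤ t := by
    by_contra hlt
    have hle := (path_mem_of_le (A := arrows δ ω) (v := v) (t := t) (by linarith)).2
    rw [hright, ← hp] at hle
    rcases le_max_iff.1 hle with h' | h' <;> linarith
  rw [path_of_le ht, ← hp] at hright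
  obtain ⟨k, θ, hθ, hθ', hk⟩ := exists_floor (sub_nonneg.2 ht)
  rw [hk, vertexPath_add k hθ hθ'.le] at hright
  obtain ⟨j, hj, hhit⟩ : ∃ j ≤ k + 1, u.1 + w ≤ ((pos (arrows δ ω) p j).1 : ℝ) := by
    by_contra hcon
    push Not at hcon
    have := hcon k (by omega)
    have := hcon (k + 1) le_rfl
    nlinarith
  have hhit' : m + 1 ≤ (pos (arrows δ ω) p j).1 := by
    have : ((m + 1 : ℤ) : ℝ) ≤ (pos (arrows δ ω) p j).1 := by push_cast; linarith
    exact_mod_cast this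
  have hpl : p.1 ≤ l := by
    have : (p.1 : ℝ) < ((l + 1 : ℤ) : ℝ) := by push_cast; linarith
    exact Int.lt_add_one_iff.1 (by exact_mod_cast this)
  have h1 : n ≤ p.2 := by
    have : (n : ℝ) ≤ p.2 := by linarith
    exact_mod_cast this
  have h2 : p.2 + (j : ℤ) ≤ n' := by
    have hj' : (j : ℝ) ≤ k + 1 := by exact_mod_cast hj
    have : p.2 + (j : ℝ) ≤ n' := by linarith
    exact_mod_cast this
  exact horizontal_mono h1 h2 h1 h2 (mem_horizontal_of_hit hlm (landing_mem_Ld v) hpl hhit')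

lemma mem_H_of_horizontal {a b c d : ℤ} (hw : 1 ≤ w) (hl : (l : ℝ) ≤ u.1)
    (hm : u.1 + w ≤ m + 1) (ha : u.2 + 1 ≤ a) (hd : (d : ℝ) ≤ u.2 + h)
    (hA : arrows δ ω ∈ horizontal l m a b c d) : ω ∈ H δ u w h := by
  set A := arrows δ ω with hAdef
  have hc1 := Int.le_ceil u.1
  have hc2 := Int.ceil_lt_add_one u.1
  have hr1 := Int.le_ceil (u.1 + w)
  have hr2 := Int.ceil_lt_add_one (u.1 + w)
  set x := ⌈u.1⌉
  set r := ⌈u.1 + w⌉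
  have hxr : x < r := by
    refine Int.lt_ceil.2 ?_
    linarith
  have hlx : l ≤ x := by
    have : (l : ℝ) ≤ x := by linarith
    exact_mod_cast this
  have hrm : r ≤ m + 1 := Int.ceil_le.2 (by push_cast; exact hm)
  obtain ⟨p, hp, hp1, hpa, -, hex⟩ := horizontal_shrink (l' := x) (m' := r - 1) hlx (by omega)
    (by omega) hA
  -- The first time at which the walk is on the column `r`.
  obtain ⟨k, hkd, hk, hkl, hmin⟩ : ∃ k : ℕ, p.2 + k ≤ d ∧
      r ≤ (pos (restrictArrows (r - 1) A) p k).1 ∧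
      (∀ j ≤ k, x ≤ (pos (restrictArrows (r - 1) A) p j).1) ∧
        ∀ j < k, (pos (restrictArrows (r - 1) A) p j).1 < r := by
    obtain ⟨k, -, hkd, hk, hkl⟩ := hex
    have hex : ∃ i, r ≤ (pos (restrictArrows (r - 1) A) p i).1 := ⟨k, by omega⟩
    classical
    have hik := Nat.find_min' hex (by omega : r ≤ (pos (restrictArrows (r - 1) A) p k).1)
    exact ⟨Nat.find hex, by omega, Nat.find_spec hex, fun j hj => hkl j (by omega),
      fun j hj => not_le.1 (Nat.find_min hex hj)⟩
  have heq : ∀ j ≤ k, pos (restrictArrows (r - 1) A) p j = pos A p j := fun j hj =>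
    pos_congr fun i hi => ⟨fun h => h.1, fun h => ⟨h, by have := hmin i (by omega); omega⟩⟩
  rw [heq k le_rfl] at hk
  have hk0 : k ≠ 0 := by
    rintro rfl
    rw [pos_zero] at hk
    omega
  obtain ⟨k, rfl⟩ := Nat.exists_eq_add_one_of_ne_zero hk0
  have hlo : ∀ j ≤ k + 1, (u.1 : ℝ) ≤ (pos A p j).1 := fun j hj => by
    have := hkl j hj
    rw [heq j hj] at this
    have : (x : ℝ) ≤ (pos A p j).1 := by exact_mod_cast this
    linarith
  have hhi : ∀ j ≤ k, ((pos A p j).1 : ℝ) ≤ r - 1 := fun j hj => by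
    have := hmin j (by omega)
    rw [heq j (by omega)] at this
    have h' : (pos A p j).1 ≤ r - 1 := by omega
    have : ((pos A p j).1 : ℝ) ≤ ((r - 1 : ℤ) : ℝ) := by exact_mod_cast h'
    push_cast at this
    exact this
  have hstep := next_fst (A := A) (p := pos A p k)
  rw [← pos_succ] at hstep
  have hkm := hmin k (by omega)
  rw [heq k (by omega)] at hkm
  have e1 : (pos A p k).1 = r - 1 := by omega
  have e2 : (pos A p (k + 1)).1 = r := by omega
  -- The trajectory starts on the edge that leads to the vertex `p`.
  set ρ : ℝ := x - u.1 with hρ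
  have hland : landing (u.1, p.2 - ρ) = p := by
    have := landing_edge (x := p.1) (n := p.2) (r := ρ) hp (by linarith) (by linarith)
    rwa [hp1, hρ, sub_sub_cancel, ← hρ, ← hp1] at this
  have hτ : ((landing (u.1, p.2 - ρ)).2 : ℝ) - (u.1, p.2 - ρ).2 = ρ := by
    rw [hland]
    simp
  have hpa' : (a : ℝ) ≤ p.2 := by exact_mod_cast hpa
  have hkd' : (p.2 : ℝ) + (k + 1) ≤ d := by exact_mod_cast hkd
  set θ : ℝ := u.1 + w - (r - 1) with hθ
  have hval : ∀ s, 0 ≤ s → s ≤ θ → vertexPath A p (k + s) = r - 1 + s := by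
    intro s hs hs'
    rw [vertexPath_add k hs (by linarith), e1, e2]
    push_cast
    ring
  have hpath : ∀ s, 0 ≤ s → s ≤ ρ + k + θ →
      u.1 ≤ path A (u.1, p.2 - ρ) s ∧ path A (u.1, p.2 - ρ) s ≤ u.1 + w := by
    intro s hs hs'
    rcases le_total s ρ with hsρ | hsρ
    · have := path_mem_of_le (A := A) (v := (u.1, p.2 - ρ)) (t := s) (by rw [hτ]; exact hsρ)
      rw [hland, hp1] at this
      simp only [min_eq_left hc1, max_eq_right hc1] at this
      exact ⟨this.1, by linarith⟩
    · rw [path_of_le (by rw [hτ]; exact hsρ), hτ, hland]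
      rcases le_total (s - ρ) k with hsk | hsk
      · exact ⟨le_vertexPath (fun j hj => hlo j (by omega)) (by linarith) hsk,
          (vertexPath_le hhi (by linarith) hsk).trans (by linarith)⟩
      · rw [show s - ρ = k + (s - ρ - k) by ring, hval _ (by linarith) (by linarith)]
        have := hlo k (by omega)
        rw [e1] at this
        push_cast at this
        constructor <;> linarith
  have hbox : ∀ s, 0 ≤ s → s ≤ ρ + k + θ →
      (X δ ω (u.1, p.2 - ρ) s, p.2 - ρ + s) ∈ box u w h := fun s hs hs' =>
    ⟨(hpath s hs hs').1, (hpath s hs hs').2, by simp only; linarith, by simp only; linarith⟩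
  have hk' := k.cast_nonneg (α := ℝ)
  have hend : X δ ω (u.1, p.2 - ρ) (ρ + k + θ) = u.1 + w := by
    rw [X, path_of_le (by rw [hτ]; linarith), hτ, hland,
      show ρ + k + θ - ρ = k + θ by ring, ← hAdef, hval θ (by linarith) le_rfl]
    ring
  refine ⟨(u.1, p.2 - ρ), ⟨⟨le_rfl, by simp only; linarith, by simp only; linarith,
    by simp only; linarith⟩, rfl⟩, ρ + k + θ, by linarith, ⟨hbox _ (by linarith) le_rfl, hend⟩,
    hbox⟩

end

section

/-! ### The fluctuation scale -/

lemma volume_rhombus_ne_zero : volume rhombus ≠ 0 := by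
  refine (lt_of_lt_of_le (Metric.measure_ball_pos volume (0 : ℝ × ℝ) one_half_pos)
    (measure_mono ?_)).ne'
  intro u hu
  rw [mem_ball_zero_iff, Prod.norm_def, max_lt_iff, Real.norm_eq_abs, Real.norm_eq_abs] at hu
  simp only [rhombus, Set.mem_ofPred_eq]
  linarith

lemma volume_rhombus_ne_top : volume rhombus ≠ ∞ := by
  refine (lt_of_le_of_lt (measure_mono ?_)
    (measure_closedBall_lt_top (x := (0 : ℝ × ℝ)) (r := 1))).ne
  intro u hu
  simp only [rhombus, Set.mem_ofPred_eq] at hu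
  rw [mem_closedBall_zero_iff, Prod.norm_def, max_le_iff, Real.norm_eq_abs, Real.norm_eq_abs]
  constructor <;> linarith [abs_nonneg u.1, abs_nonneg u.2]

/-- Averages over the rhombus are ordered if the functions are separated by constants. No
measurability is needed for this comparison. -/
lemma average_lt_average {f g : ℝ × ℝ → ℝ≥0∞} {a b : ℝ≥0∞} (hf : ∀ u, f u ≤ a) (hg : ∀ u, b ≤ g u)
    (hab : a < b) : (volume rhombus)⁻¹ * ∫⁻ u in rhombus, f u <
      (volume rhombus)⁻¹ * ∫⁻ u in rhombus, g u := by
  have hc : ∀ c : ℝ≥0∞, (volume rhombus)⁻¹ * ∫⁻ _ in rhombus, c = c := fun c => by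
    rw [setLIntegral_const, mul_comm c, ← mul_assoc,
      ENNReal.inv_mul_cancel volume_rhombus_ne_zero volume_rhombus_ne_top, one_mul]
  calc _ ≤ (volume rhombus)⁻¹ * ∫⁻ _ in rhombus, a := by gcongr; exact hf _
    _ = a := hc a
    _ < b := hab
    _ = (volume rhombus)⁻¹ * ∫⁻ _ in rhombus, b := (hc b).symm
    _ ≤ _ := by gcongr; exact hg _

lemma exists_mem_Ld (a n : ℤ) : ∃ l, (l = a ∨ l = a + 1) ∧ (l, n) ∈ Ld := by
  simp only [Ld, Set.mem_ofPred_eq, Int.even_iff, Int.odd_iff]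
  by_cases h : (a + n) % 2 = 0
  · exact ⟨a, Or.inl rfl, by omega⟩
  · exact ⟨a + 1, Or.inr rfl, by omega⟩

lemma exists_neg_mem_Ld (a n D : ℤ) : ∃ l, (l = a ∨ l = a + 1) ∧ (-(l + D), n) ∈ Ld := by
  simp only [Ld, Set.mem_ofPred_eq, Int.even_iff, Int.odd_iff]
  by_cases h : (a + D + n) % 2 = 0
  · exact ⟨a, Or.inl rfl, by omega⟩
  · exact ⟨a + 1, Or.inr rfl, by omega⟩

variable {μ : Measure Env} [IsProbabilityMeasure μ] {δ h w : ℝ}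

/-- The widths over which the supremum is taken in the definition of the fluctuation scale. -/
def admissibleWidths (μ : Measure Env) (δ h : ℝ) : Set ℝ :=
  {w : ℝ | 1 ≤ w ∧
    (volume rhombus)⁻¹ * ∫⁻ u in rhombus, annealed μ (V δ u w h) ≤
      (volume rhombus)⁻¹ * ∫⁻ u in rhombus, annealed μ (H δ u w h)}

lemma annealed_le_of_prob {S : Set Sample} {E : Set (Set (ℤ × ℤ))}
    (hS : ∀ ω ∈ S, arrows δ ω ∈ E) : annealed μ S ≤ ENNReal.ofReal (prob μ δ E) := by
  rw [prob, ofReal_measureReal]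
  exact measure_mono hS

lemma prob_le_annealed {S : Set Sample} {E : Set (Set (ℤ × ℤ))}
    (hS : ∀ ω, arrows δ ω ∈ E → ω ∈ S) : ENNReal.ofReal (prob μ δ E) ≤ annealed μ S := by
  rw [prob, ofReal_measureReal]
  exact measure_mono hS

/-- At an admissible width, slightly narrower discrete horizontal crossings are likely: otherwise,
by duality, vertical crossings would beat horizontal ones uniformly in the anchor point. -/
lemma le_prob_horizontal_of_mem (hμT : TranslationInvariant μ) (hμR : ReflectionInvariant μ)
    (hδ : 0 ≤ δ) (hδ' : δ ≤ 1 / 2) {M : ℕ} (hh : 0 ≤ h) (hM : h + 4 ≤ M)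
    (hw : w ∈ admissibleWidths μ δ h) :
    1 / 3 ≤ prob μ δ (horizontal 0 (max (⌊w⌋ - 3) (-1)) 0 (0 + M) 0 (0 + M)) := by
  obtain ⟨hw1, hw⟩ := hw
  rcases lt_or_ge (⌊w⌋ - 3) 0 with hneg | hD
  · rw [max_eq_right (by omega)]
    have : prob μ δ Set.univ ≤ prob μ δ (horizontal 0 (-1) 0 (0 + M) 0 (0 + M)) :=
      prob_mono fun A _ _ => ⟨(0, 0), Or.inl ⟨Even.zero, Even.zero⟩, rfl, le_rfl, by simp, 0,
        by simp, by simp, by simp, fun j hj => by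
          rw [Nat.le_zero.1 hj, pos_zero]⟩
    have h1 : prob μ δ Set.univ = 1 := by simp [prob]
    linarith
  · rw [max_eq_left (by omega)]
    have hwf := Int.floor_le w
    set D := ⌊w⌋ - 3 with hDdef
    have hDr : (D : ℝ) = ⌊w⌋ - 3 := by rw [hDdef]; push_cast; ring
    by_contra! hx
    set x := prob μ δ (horizontal 0 D 0 (0 + M) 0 (0 + M)) with hxdef
    refine absurd hw (not_le.2 (average_lt_average (a := ENNReal.ofReal x)
      (b := ENNReal.ofReal (1 - x)) (fun u => ?_) (fun u => ?_)
      ((ENNReal.ofReal_lt_ofReal_iff (by linarith)).2 (by linarith))))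
    · obtain ⟨l, hl, hz⟩ := exists_mem_Ld ⌈u.1⌉ ⌊u.2⌋
      have hl1 : u.1 ≤ l ∧ (l : ℝ) < u.1 + 2 := by
        have := Int.le_ceil u.1
        have := Int.ceil_lt_add_one u.1
        rcases hl with rfl | rfl <;> push_cast <;> constructor <;> linarith
      have hf := Int.floor_le u.2
      have hf' := Int.lt_floor_add_one u.2
      rw [hxdef, prob_horizontal_translate hμT hδ hδ' hz]
      refine annealed_le_of_prob fun ω hω => ?_
      simp only [zero_add]
      exact mem_horizontal_of_H (n' := M + ⌊u.2⌋) hw1 (by omega) hl1.1 (by push_cast; linarith) hf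
        (by push_cast; linarith) hω
    · obtain ⟨l, hl, hz⟩ := exists_neg_mem_Ld ⌈u.1⌉ ⌈u.2⌉ D
      have hl1 : u.1 ≤ l ∧ (l : ℝ) < u.1 + 2 := by
        have := Int.le_ceil u.1
        have := Int.ceil_lt_add_one u.1
        rcases hl with rfl | rfl <;> push_cast <;> constructor <;> linarith
      have hdual := one_le_prob_add_prob (μ := μ) (l := l) (m := l + D) (n := ⌈u.2⌉) (N := M) hμR
        hδ hδ' (by omega)
      have ht := prob_horizontal_translate (μ := μ) (l := 0) (m := D) (a := 0) (b := 0 + M) (c := 0)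
        (d := 0 + M) hμT hδ hδ' hz
      rw [← hxdef] at ht
      simp only [zero_add] at ht
      rw [show D + -(l + D) = -l by ring, add_comm (M : ℤ)] at ht
      rw [← ht] at hdual
      refine (ENNReal.ofReal_le_ofReal (sub_le_iff_le_add.2 hdual)).trans
        (prob_le_annealed fun ω hω => ?_)
      have hMr : 1 ≤ M := by
        have : (1 : ℝ) ≤ M := by linarith
        exact_mod_cast this
      exact mem_V_of_vertical (by linarith) hh hMr hl1.1 (by push_cast; linarith) (Int.le_ceil _)
        (Int.ceil_lt_add_one _) (by linarith [Int.le_ceil u.2]) hω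

/-- At a width that is not admissible, slightly wider discrete vertical crossings are likely. -/
lemma le_prob_vertical_of_notMem (hμT : TranslationInvariant μ) (hμR : ReflectionInvariant μ)
    (hδ : 0 ≤ δ) (hδ' : δ ≤ 1 / 2) {N : ℕ} (hN : (N : ℝ) + 3 ≤ h) (hw1 : 1 ≤ w)
    (hw : w ∉ admissibleWidths μ δ h) : 1 / 3 ≤ prob μ δ (vertical 0 (⌊w⌋ + 2) 0 N) := by
  have hwf := Int.lt_floor_add_one w
  have hD : 0 ≤ ⌊w⌋ + 2 := by
    have : (0 : ℤ) ≤ ⌊w⌋ := Int.floor_nonneg.2 (by linarith)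
    omega
  set D := ⌊w⌋ + 2 with hDdef
  have hDr : (D : ℝ) = ⌊w⌋ + 2 := by rw [hDdef]; push_cast; ring
  by_contra! hx
  set x := prob μ δ (vertical 0 D 0 N) with hxdef
  refine hw ⟨hw1, (average_lt_average (a := ENNReal.ofReal x)
    (b := ENNReal.ofReal (1 - x)) (fun u => ?_) (fun u => ?_)
    ((ENNReal.ofReal_lt_ofReal_iff (by linarith)).2 (by linarith))).le⟩
  · obtain ⟨l, hl, hz⟩ := exists_mem_Ld (⌈u.1⌉ - 1) (⌈u.2⌉ + 2)
    have hl1 : u.1 ≤ l + 1 ∧ (l : ℝ) < u.1 + 1 := by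
      have := Int.le_ceil u.1
      have := Int.ceil_lt_add_one u.1
      rcases hl with rfl | rfl <;> push_cast <;> constructor <;> linarith
    have hc := Int.le_ceil u.2
    have hc' := Int.ceil_lt_add_one u.2
    rw [hxdef, prob_vertical_translate hμT hδ hδ' hz]
    refine annealed_le_of_prob fun ω hω => ?_
    exact mem_vertical_of_V (by push_cast; linarith) (by push_cast; linarith)
      (by push_cast; linarith) (by push_cast; linarith) hω
  · obtain ⟨l, hl, hz⟩ := exists_neg_mem_Ld (⌊u.1⌋ - 1) (⌈u.2⌉ + 1) D
    have hl1 : (l : ℝ) ≤ u.1 ∧ u.1 < l + 2 := by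
      have := Int.floor_le u.1
      have := Int.lt_floor_add_one u.1
      rcases hl with rfl | rfl <;> push_cast <;> constructor <;> linarith
    have hc := Int.le_ceil u.2
    have hc' := Int.ceil_lt_add_one u.2
    have hdual := one_le_prob_add_prob (μ := μ) (l := -(l + D)) (m := -l) (n := ⌈u.2⌉ + 1) (N := N)
      hμR hδ hδ' (by omega)
    have ht := prob_vertical_translate (μ := μ) (l := 0) (m := D) (n := 0) (N := N) hμT hδ hδ' hz
    rw [← hxdef] at ht
    simp only [zero_add] at ht
    rw [show D + -(l + D) = -l by ring] at ht
    rw [← ht, neg_neg, neg_neg] at hdual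
    refine (ENNReal.ofReal_le_ofReal (sub_le_iff_le_add'.2 hdual)).trans
      (prob_le_annealed fun ω hω => ?_)
    exact mem_H_of_horizontal hw1 hl1.1 (by push_cast; linarith) (by push_cast; linarith)
      (by push_cast; linarith) hω

lemma bddAbove_admissibleWidths (hμT : TranslationInvariant μ) (hμR : ReflectionInvariant μ)
    (hδ : 0 ≤ δ) (hδ' : δ ≤ 1 / 2) (hh : 0 ≤ h) : BddAbove (admissibleWidths μ δ h) := by
  refine ⟨⌈h + 4⌉₊ + 3, fun w hw => ?_⟩
  have hprob := le_prob_horizontal_of_mem hμT hμR hδ hδ' hh (Nat.le_ceil (h + 4)) hw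
  set M := ⌈h + 4⌉₊
  have hne : (horizontal 0 (max (⌊w⌋ - 3) (-1)) 0 (0 + M) 0 (0 + M)).Nonempty := by
    by_contra hemp
    rw [Set.not_nonempty_iff_eq_empty.1 hemp] at hprob
    norm_num [prob] at hprob
  obtain ⟨A, p, -, h1, h2, -, k, -, h4, h5, -⟩ := hne
  have h6 := pos_fst_le (A := restrictArrows (max (⌊w⌋ - 3) (-1)) A) (p := p) (k := k)
  have h7 : ⌊w⌋ + 1 ≤ M + 3 := by
    have := le_max_left (⌊w⌋ - 3) (-1)
    omega
  have h8 : (⌊w⌋ : ℝ) + 1 ≤ M + 3 := by exact_mod_cast h7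
  linarith [Int.lt_floor_add_one w]

lemma one_mem_admissibleWidths {c₀ : ℝ} (hc₀ : 0 < c₀) (hc₀' : c₀ < 1 / 2)
    (hμT : TranslationInvariant μ) (hμR : ReflectionInvariant μ) (hδ : 0 ≤ δ)
    (hδ' : δ < 1 / 2 - c₀) {k : ℕ} (hk : (1 - c₀ ^ 20) ^ k < 1 / 3) (hh : 5 * (k : ℝ) + 3 ≤ h) :
    1 ∈ admissibleWidths μ δ h := by
  by_contra hcon
  have h1 := le_prob_vertical_of_notMem (N := 5 * k) hμT hμR hδ (by linarith)
    (by push_cast; linarith) le_rfl hcon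
  have h2 := prob_vertical_strip_le (μ := μ) hc₀ hc₀' hδ hδ' k
  simp only [Int.floor_one] at h1
  norm_num at h1 hk
  linarith

end

end RWDRE

open RWDRE in
theorem proposition4p4 (c₀ : ℝ) (hc₀ : 0 < c₀) (hc₀' : c₀ < 1 / 2) :
    ∃ c : ℝ, 0 < c ∧
      ∀ (μ : MeasureTheory.Measure RWDRE.Env) (_ : MeasureTheory.IsProbabilityMeasure μ)
        (_ : RWDRE.TranslationInvariant μ) (_ : RWDRE.ReflectionInvariant μ) (_ : RWDRE.FKG μ)
        (δ : ℝ) (_ : 0 ≤ δ) (_ : δ < 1 / 2 - c₀) (h : ℝ) (_ : max 64 c ≤ h),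
        c₀ ^ 360 / 16 ^ 30 ≤
          ⨅ u : ℝ × ℝ, (RWDRE.annealed μ).real
            (RWDRE.V δ u (RWDRE.fluctuationScale μ δ h + 4) (5 * h)) := by
  have hpos : 0 < c₀ ^ 20 := pow_pos hc₀ _
  have hlt : c₀ ^ 20 < 1 := pow_lt_one₀ hc₀.le (by linarith) (by norm_num)
  obtain ⟨k, hk⟩ := exists_pow_lt_of_lt_one (by norm_num : (0 : ℝ) < 1 / 3)
    (by linarith : 1 - c₀ ^ 20 < 1)
  refine ⟨5 * k + 200, by positivity, fun μ _ hμT hμR hF δ hδ hδ' h hh => ?_⟩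
  have hδ2 : δ ≤ 1 / 2 := by linarith
  have hh := (le_max_right _ _).trans hh
  have hk0 := k.cast_nonneg (α := ℝ)
  have hmem := one_mem_admissibleWidths (h := h) hc₀ hc₀' hμT hμR hδ hδ' hk (by linarith)
  have hbdd := bddAbove_admissibleWidths (h := h) hμT hμR hδ hδ2 (by linarith)
  have hscale : fluctuationScale μ δ h = sSup (admissibleWidths μ δ h) := rfl
  set W := fluctuationScale μ δ h with hW
  have hW1 : 1 ≤ W := hscale ▸ le_csSup hbdd hmem
  set D := ⌊W⌋ + 3 with hD
  -- In units of `4`, the height is `j + 6`. The slabs have length `2 * j + 20`, which is `h / 2` up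
  -- to a constant, and each lengthening step gains `2 * j`.
  obtain ⟨j, hj1, hj2⟩ : ∃ j : ℕ, 4 * ((j : ℝ) + 6) ≤ h ∧ h < 4 * (j + 7) := by
    have h1 := Nat.floor_le (by linarith : 0 ≤ h / 4)
    have h2 := Nat.lt_floor_add_one (h / 4)
    have h3 : 6 ≤ ⌊h / 4⌋₊ := Nat.le_floor (by push_cast; linarith)
    refine ⟨⌊h / 4⌋₊ - 6, ?_, ?_⟩ <;> push_cast [h3] <;> linarith
  have hVert : 1 / 3 ≤ prob μ δ (vertical 0 D 0 ((2 * j + 20) + 2 * j)) := by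
    have hnot : W + 1 ∉ admissibleWidths μ δ h :=
      notMem_of_csSup_lt (by rw [← hscale]; linarith) hbdd
    have := le_prob_vertical_of_notMem (N := (2 * j + 20) + 2 * j) hμT hμR hδ hδ2
      (by push_cast; linarith) (by linarith) hnot
    rwa [Int.floor_add_one, show ⌊W⌋ + 1 + 2 = D by rw [hD]; ring] at this
  -- The strip has at most `7` columns more than a likely horizontal crossing.
  obtain ⟨M, hM, hHor⟩ : ∃ M : ℕ, M ≤ 2 * (2 * j + 20) ∧
      c₀ ^ 7 / 3 ≤ prob μ δ (horizontal 0 D 0 (0 + M) 0 (0 + M)) := by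
    obtain ⟨w, hw, hwW⟩ := exists_lt_of_lt_csSup ⟨1, hmem⟩ (by rw [← hscale]; linarith : W - 1 < _)
    have hle : w ≤ W := hscale ▸ le_csSup hbdd hw
    have hf1 : ⌊w⌋ ≤ ⌊W⌋ := Int.floor_le_floor hle
    have hf2 : ⌊W⌋ - 1 ≤ ⌊w⌋ := by
      rw [← Int.floor_sub_one]
      exact Int.floor_le_floor hwW.le
    have hf3 : 0 ≤ ⌊W⌋ := Int.floor_nonneg.2 (by linarith)
    have hp := le_prob_horizontal_of_mem (M := 4 * j + 32) hμT hμR hδ hδ2 (by linarith)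
      (by push_cast; linarith) hw
    obtain ⟨i, hi⟩ : ∃ i : ℕ, max (⌊w⌋ - 3) (-1) + i = D :=
      ⟨(D - max (⌊w⌋ - 3) (-1)).toNat, by omega⟩
    have hb := pow_mul_prob_horizontal_le (μ := μ) (l := 0) (m := max (⌊w⌋ - 3) (-1)) (a := 0)
      (by omega) hc₀ hδ hδ' (4 * j + 32) i
    rw [hi] at hb
    refine ⟨4 * j + 32 + i, by omega, le_trans ?_ hb⟩
    have h7 : c₀ ^ 7 ≤ c₀ ^ i := pow_le_pow_of_le_one hc₀.le (by linarith) (by omega)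
    have := mul_le_mul h7 hp (by norm_num) (by positivity)
    linarith
  have hiter := le_prob_vertical_iterate hμT hF hδ hδ2 (K := 2 * j + 20) (G := 2 * j)
    ⟨j + 10, by ring⟩ ⟨j, by ring⟩ hM (by norm_num : (0 : ℝ) ≤ 1 / 3)
    (by positivity : 0 ≤ c₀ ^ 7 / 3) hVert hHor 10
  have hconst : c₀ ^ 360 / 16 ^ 30 ≤ 1 / 3 * (c₀ ^ 7 / 3 / 3 * (1 / 3)) ^ 10 := by
    have h1 : c₀ ^ 360 ≤ c₀ ^ 70 := pow_le_pow_of_le_one hc₀.le (by linarith) (by norm_num)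
    have h2 : 0 < c₀ ^ 70 := pow_pos hc₀ _
    rw [show 1 / 3 * (c₀ ^ 7 / 3 / 3 * (1 / 3)) ^ 10 = c₀ ^ 70 / 3 ^ 31 by ring]
    gcongr
    norm_num
  refine le_ciInf fun u => (hconst.trans hiter).trans ?_
  have hl := Int.le_ceil u.1
  have hl' := Int.ceil_lt_add_one u.1
  have hn := Int.le_ceil u.2
  have hDW : (D : ℝ) ≤ W + 3 := by
    rw [hD]
    push_cast
    linarith [Int.floor_le W]
  have hincl : prob μ δ (vertical ⌈u.1⌉ (⌈u.1⌉ + D) ⌈u.2⌉ (24 * j + 19)) ≤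
      (annealed μ).real (V δ u (W + 4) (5 * h)) :=
    measureReal_mono fun ω hω => mem_V_of_vertical (by linarith) (by linarith) (by omega) hl
      (by push_cast; linarith) hn (Int.ceil_lt_add_one _) (by push_cast; linarith) hω
  refine le_trans ?_ hincl
  -- The strip can only be translated by vectors of `𝕃_d`, so one time step may be lost.
  obtain ⟨i, hi, hz⟩ : ∃ i : ℤ, (i = 0 ∨ i = 1) ∧ (⌈u.1⌉, ⌈u.2⌉ - i) ∈ Ld := by
    simp only [Ld, Set.mem_ofPred_eq, Int.even_iff, Int.odd_iff]
    by_cases hpar : (⌈u.1⌉ + ⌈u.2⌉) % 2 = 0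
    · exact ⟨0, Or.inl rfl, by omega⟩
    · exact ⟨1, Or.inr rfl, by omega⟩
  rw [prob_vertical_translate hμT hδ hδ2 hz]
  exact prob_mono fun A _ hA => vertical_mono (by simp) (by simp [add_comm]) (by simp; omega)
    (by push_cast; omega) hA
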